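/- A $G$-tree $S$ is a non-empty combinatorial tree on which the group $G$ acts from the left by graph automorphisms without inverting edges; $G_v$ and $G_e$ denote stabilizers of vertices and edges, $\bar S=G\backslash S$ is the quotient graph, and for an edge $e$ of $\bar S$ the group $G(e)$ is the stabilizer of a lift of $e$ (well defined up to conjugacy). $S$ is *reduced* if for every edge $e$ of $S$ and each end point $u$ of $e$ with $G_e=G_u$, the two end points of $e$ lie in the same $G$-orbit. A *compressing forest* of $S$ is a subgraph of $\bar S$ without circuits, with edge set $F$, whose edges can be oriented so that each vertex of $\bar S$ has at most one arrow pointing away from it and so that every arrow has a lift $e$ to $S$, starting in $u$ say, with $G_e=G_u$; and $F$ is required to be maximal among the edge sets with these properties. Compressing the edges over $F$ turns $S$ into a reduced $G$-tree $S^*$, the edges of whose quotient graph are the edges of $\bar S$ outside $F$, with the same edge groups. (If $S$ is reduced, then $F=\emptyset$ and $S^*=S$.) **Theorem.** Let $G$ be a finitely generated group, let $d(G)$ be its minimal number of generators, and let $S$ be a $G$-tree all of whose edge stabilizers are finite. 1. If $S$ is reduced, then $\bar S$ has only finitely many edges and $$\eta(S)=\sum_{e\in E\bar S}\frac1{|G(e)|}\le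 d(G).$$ In particular, if moreover all edge stabilizers are trivial, then $\bar S$ has at most $d(G)$ edges. 2. If $S$ is not necessarily reduced but $\bar S$ has only finitely many edges, then for every compressing forest of $S$, with edge set $F$, $$\eta(S)=\sum_{e\in E\bar S\setminus F}\frac1{|G(e)|}\le d(G),$$ where the sum runs over the edges of the quotient graph of the reduced tree $S^*$. -/

import Mathlib

open scoped ENNReal

/-- A `G`-tree with vertex set `V`: a (nonempty) combinatorial tree on which the group `G` acts on
the left by graph automorphisms, without inverting an edge. -/
structure GTree (G : Type*) [Group G] (V : Type*) [MulAction G V] where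
  graph : SimpleGraph V
  isTree : graph.IsTree
  adj_smul : ∀ (g : G) {u v : V}, graph.Adj u v → graph.Adj (g • u) (g • v)
  no_inversion : ∀ (g : G) {u v : V}, graph.Adj u v → ¬ (g • u = v ∧ g • v = u)

namespace GTree

variable {G : Type*} [Group G] {V : Type*} [MulAction G V] (S : GTree G V)

/-- The edges of the tree; each geometric (unoriented) edge occurs once. -/
def Edge : Type _ := {e : Sym2 V // e ∈ S.graph.edgeSet}

/-- The edge with end points `u` and `v`. -/
def edge {u v : V} (h : S.graph.Adj u v) : S.Edge := ⟨s(u, v), h⟩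

theorem map_smul_mem_edgeSet (g : G) (e : Sym2 V) (he : e ∈ S.graph.edgeSet) :
    Sym2.map (fun v : V => g • v) e ∈ S.graph.edgeSet := by
  induction e using Sym2.ind with
  | _ u v => exact S.adj_smul g he

/-- The action of `G` on the edges induced by the action on the vertices. The stabilizer `G_e` of
an edge is `MulAction.stabilizer G e`. -/
instance : MulAction G S.Edge where
  smul g e := ⟨Sym2.map (fun v : V => g • v) e.1, S.map_smul_mem_edgeSet g e.1 e.2⟩
  one_smul e := by
    apply Subtype.ext
    change Sym2.map (fun v : V => (1 : G) • v) e.1 = e.1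
    simp
  mul_smul g h e := by
    apply Subtype.ext
    change Sym2.map (fun v : V => (g * h) • v) e.1 =
      Sym2.map (fun v : V => g • v) (Sym2.map (fun v : V => h • v) e.1)
    rw [Sym2.map_map]
    congr 1
    funext v
    exact mul_smul g h v

/-- The edges of the quotient graph `G \ S`, that is, the `G`-orbits of edges of `S`. -/
abbrev QuotEdge : Type _ := MulAction.orbitRel.Quotient G S.Edge

/-- The edge of the quotient graph `G \ S` that is the orbit of `e`. -/
def quotMk (e : S.Edge) : S.QuotEdge := Quotient.mk (MulAction.orbitRel G S.Edge) e

/-- The term `1 / |G(e)|` for an edge `e` of the quotient graph, where `G(e)` is the stabilizer of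
any lift of `e` to the tree (and `1 / ∞ = 0`). -/
noncomputable def weight : S.QuotEdge → ℝ≥0∞ :=
  Quotient.lift (fun e : S.Edge => ((ENat.card (MulAction.stabilizer G e) : ℕ∞) : ℝ≥0∞)⁻¹)
    (fun _ _ h => by
      rw [ENat.card_congr (MulAction.stabilizerEquivStabilizerOfOrbitRel h).toEquiv])

/-- All edge stabilizers are finite. -/
def FiniteEdgeStabilizers : Prop :=
  ∀ e : S.Edge, Finite (MulAction.stabilizer G e)

/-- `S` is reduced: no edge is compressible, i.e. whenever the stabilizer of an edge equals the
stabilizer of one of its end points, the two end points lie in the same orbit. (Both orientations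
of each edge are covered, as `(u, v)` ranges over all ordered pairs of adjacent vertices.) -/
def IsReduced : Prop :=
  ∀ (u v : V) (h : S.graph.Adj u v),
    MulAction.stabilizer G (S.edge h) = MulAction.stabilizer G u → v ∈ MulAction.orbit G u

/-- The sum of `1 / |G(e)|` over all edges `e` of `G \ S`; this is `η(S)` when `S` is reduced. -/
noncomputable def eta : ℝ≥0∞ := ∑' x : S.QuotEdge, S.weight x

/-- An oriented forest in the quotient graph `G \ S` along which vertices of `S` can be compressed.
It is given by its preimage in `S`: `A u v` means that the edge from `u` to `v` is in the
preimage, with its arrow pointing from `u` to `v`. -/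
structure IsCompressing (A : V → V → Prop) : Prop where
  adj : ∀ {u v : V}, A u v → S.graph.Adj u v
  /-- `A` is the full preimage of a set of arrows of the quotient graph. -/
  smul : ∀ (g : G) {u v : V}, A u v → A (g • u) (g • v)
  /-- An arrow from `u` to `v` lies on an edge `e` with `G_e = G_u`. -/
  stabilizer_eq : ∀ {u v : V} (h : S.graph.Adj u v), A u v →
    MulAction.stabilizer G (S.edge h) = MulAction.stabilizer G u
  /-- Each vertex of the quotient graph has at most one arrow pointing away from it: two arrows
  starting in the same vertex orbit lie in the same orbit of arrows. -/
  out_unique : ∀ (g : G) {u v w : V}, A u v → A (g • u) w → ∃ k : G, k • u = g • u ∧ k • v = w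
  /-- The arrows form a forest in the quotient graph. As every vertex has at most one arrow
  pointing away from it, each circuit would be a directed one, that is, the image of a directed
  path of `S` which joins two vertices of the same orbit. -/
  acyclic : ∀ (g : G) (u : V), ¬ Relation.TransGen A u (g • u)

/-- The edges of the quotient graph that carry an arrow of `A`. -/
def forestEdges (A : V → V → Prop) : Set S.QuotEdge :=
  {x | ∃ (u v : V) (h : S.graph.Adj u v), A u v ∧ x = S.quotMk (S.edge h)}

/-- A compressing forest of `S`: a set `F` of edges of the quotient graph `G \ S` that is the edge
set of an oriented forest as in `IsCompressing` and that is maximal, as a set of edges, with this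
property. Compressing the edges over `F` turns `S` into a reduced tree `S*`, the edges of whose
quotient are the edges of `G \ S` outside `F`, with unchanged edge groups. -/
def IsCompressingForest (F : Set S.QuotEdge) : Prop :=
  Maximal (fun F' : Set S.QuotEdge => ∃ A : V → V → Prop, S.IsCompressing A ∧ S.forestEdges A = F') F

/-- The sum of `1 / |G(e)|` over the edges `e` of `G \ S` outside `F`. If `F` is a compressing
forest, these are the edges of `G \ S*`, and the sum is `η(S)`. -/
noncomputable def etaOutside (F : Set S.QuotEdge) : ℝ≥0∞ := ∑' x : ↥Fᶜ, S.weight x.1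

end GTree

/-!
The proof is by folding. Call the sum of `1 / |G_y|` over the orbits of a `G`-set its mass, so that
`η(S)` for a reduced tree is the mass of the set of edges. Consider `G`-graphs with vertex set `W`
and edge set `E`, mapped equivariantly to `S`. If `G_x ≤ G_y` for two adjacent vertices, then the
edge between them has the stabilizer `G_x`, and compressing it removes the same mass from the edges
and from the vertices. Hence if `R` is a set of vertices that every vertex reaches along such edges,
the vertices outside `R` can be compressed, and what is left of the edges has mass
`mass E - mass (W \ R)`. The invariant of the proof (`IsResolution`) is that this number is at most
`d(G)` for some `R`. Choosing just a set `R`, and no forest, means that nothing has to be said about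
circuits.

A finite subtree of `S` times `G` is a free `G`-graph for which the number is `0`
(`GTree.isResolution_free`). Identifying the points over `s • v₀` with `s • b`, for `s` in a
generating set and a root `b` over `v₀`, raises it by at most `1` for each `s`, and makes the graph
connected (`GTree.exists_connected_resolution`). Whenever two edges with a common end point have the
same image in `S`, they can be folded, and the number does not increase (`IsResolution.exists_fold`).
This is a comparison of the orders of the few stabilizers involved, based on the fact that a proper
subgroup has at most half the order, so that either the new vertex can be afforded as a root, or it
can be compressed again. The mass of the edges drops in each fold and has a bounded denominator, so
the process ends (`IsResolution.exists_isFolded`), with a connected graph that is mapped locally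
injectively to the tree `S`, and is therefore a subtree (`GTree.exists_isBoundedSubtree`).

If `S` is reduced, then nothing can be compressed, so the subtree is `S` and `R` consists of all
vertices, and the mass of the edges is at most `d(G)`. For general `S` with a maximal compressing
forest, start with enough vertices to get all of `S`. A path of compressible edges from a sink of the
forest never leaves the component of the sink, since otherwise the forest could be reoriented and
enlarged (`GTree.IsCompressing.mem_basin_of_reflTransGen`). So each component contains a vertex of
`R` whose stabilizer is no larger than that of the sink. Hence the sinks have at most the mass of
`R`, and the forest compresses at least as much mass as `R` does.
-/

open MulAction

/-! ### Orbit masses -/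

section OrbitMass

open scoped NNReal

variable {G : Type*} [Group G] {Y Z : Type*} [MulAction G Y] [MulAction G Z]

/-- A set that is stable under the action of `G`. -/
def IsStable (G : Type*) [Group G] {Y : Type*} [MulAction G Y] (s : Set Y) : Prop :=
  ∀ (g : G), ∀ y ∈ s, g • y ∈ s

/-- The set of orbits that meet `s`. -/
def orbitsOf (G : Type*) [Group G] {Y : Type*} [MulAction G Y] (s : Set Y) :
    Set (orbitRel.Quotient G Y) :=
  Quotient.mk (orbitRel G Y) '' s

/-- The reciprocal of the order of the stabilizer of `y`. It is `0` if the stabilizer is infinite,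
since `Nat.card` is then `0`. -/
noncomputable def stabInv (G : Type*) [Group G] {Y : Type*} [MulAction G Y] (y : Y) : ℝ≥0 :=
  ((Nat.card (stabilizer G y) : ℝ≥0))⁻¹

theorem card_stabilizer_smul (g : G) (y : Y) :
    Nat.card (stabilizer G (g • y)) = Nat.card (stabilizer G y) :=
  Nat.card_congr (stabilizerEquivStabilizerOfOrbitRel
    (show orbitRel G Y (g • y) y from ⟨g, rfl⟩)).toEquiv

theorem stabInv_smul (g : G) (y : Y) : stabInv G (g • y) = stabInv G y := by
  rw [stabInv, stabInv, card_stabilizer_smul]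

theorem stabInv_le_one (y : Y) : stabInv G y ≤ 1 := by
  rw [stabInv]
  rcases Nat.eq_zero_or_pos (Nat.card (stabilizer G y)) with h | h
  · rw [h]
    simp
  · exact inv_le_one_of_one_le₀ (by exact_mod_cast h)

/-- `stabInv` as a function on orbits. -/
noncomputable def orbitWeight (G : Type*) [Group G] {Y : Type*} [MulAction G Y] :
    orbitRel.Quotient G Y → ℝ≥0∞ :=
  Quotient.lift (fun y : Y => (stabInv G y : ℝ≥0∞)) (by
    rintro a b ⟨g, rfl⟩
    simp only [stabInv_smul])

@[simp]
theorem orbitWeight_mk (y : Y) :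
    orbitWeight G (Quotient.mk (orbitRel G Y) y) = (stabInv G y : ℝ≥0∞) := rfl

/-- The mass of a subset `s` of a `G`-set: the sum over the orbits that meet `s` of the reciprocals
of the orders of the stabilizers. For the set of edges of a tree this is the sum of `1 / |G(e)|`
over the edges of the quotient graph. -/
noncomputable def mass (G : Type*) [Group G] {Y : Type*} [MulAction G Y] (s : Set Y) : ℝ≥0∞ :=
  ∑' x : orbitsOf G s, orbitWeight G x.1

theorem mk_mem_orbitsOf {s : Set Y} (hs : IsStable G s) {y : Y} :
    Quotient.mk (orbitRel G Y) y ∈ orbitsOf G s ↔ y ∈ s := by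
  constructor
  · rintro ⟨z, hz, h⟩
    obtain ⟨g, rfl⟩ := Quotient.exact h
    simpa using hs g⁻¹ _ hz
  · exact fun h => ⟨y, h, rfl⟩

theorem mk_eq_mk_iff {y z : Y} :
    Quotient.mk (orbitRel G Y) y = Quotient.mk (orbitRel G Y) z ↔ ∃ g : G, g • z = y :=
  ⟨fun h => Quotient.exact h, fun h => Quotient.sound h⟩

theorem isStable_orbit (y : Y) : IsStable G (orbit G y) := by
  rintro g _ ⟨k, rfl⟩
  exact ⟨g * k, mul_smul g k y⟩

theorem isStable_univ : IsStable G (Set.univ : Set Y) := fun _ _ _ => trivial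

theorem IsStable.union {s t : Set Y} (hs : IsStable G s) (ht : IsStable G t) :
    IsStable G (s ∪ t) := fun g y hy => hy.imp (hs g y) (ht g y)

theorem IsStable.smul_mem_iff {s : Set Y} (hs : IsStable G s) {g : G} {y : Y} :
    g • y ∈ s ↔ y ∈ s :=
  ⟨fun h => by simpa using hs g⁻¹ _ h, hs g y⟩

theorem IsStable.diff {s t : Set Y} (hs : IsStable G s) (ht : IsStable G t) :
    IsStable G (s \ t) := fun g y hy => ⟨hs g y hy.1, fun h => hy.2 (ht.smul_mem_iff.1 h)⟩

theorem IsStable.image {s : Set Y} (hs : IsStable G s) {f : Y → Z}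
    (hf : ∀ (g : G) y, f (g • y) = g • f y) : IsStable G (f '' s) := by
  rintro g _ ⟨y, hy, rfl⟩
  exact ⟨g • y, hs g y hy, hf g y⟩

theorem orbitsOf_orbit (y : Y) :
    orbitsOf G (orbit G y) = {Quotient.mk (orbitRel G Y) y} := by
  ext x
  induction x using Quotient.ind with
  | _ z =>
    rw [mk_mem_orbitsOf (isStable_orbit y), Set.mem_singleton_iff, mk_eq_mk_iff]
    rfl

theorem mass_mono {s t : Set Y} (h : s ⊆ t) : mass G s ≤ mass G t :=
  ENNReal.tsum_mono_subtype _ (Set.image_mono h)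

theorem mass_union_le (s t : Set Y) : mass G (s ∪ t) ≤ mass G s + mass G t := by
  unfold mass orbitsOf
  rw [Set.image_union]
  exact ENNReal.tsum_union_le _ _ _

theorem mass_union {s t : Set Y} (hs : IsStable G s) (ht : IsStable G t)
    (h : Disjoint s t) : mass G (s ∪ t) = mass G s + mass G t := by
  have hd : Disjoint (orbitsOf G s) (orbitsOf G t) := by
    rw [Set.disjoint_left]
    intro x
    induction x using Quotient.ind with
    | _ z =>
      rw [mk_mem_orbitsOf hs, mk_mem_orbitsOf ht]
      exact fun h1 h2 => Set.disjoint_left.1 h h1 h2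
  have hu : orbitsOf G (s ∪ t) = orbitsOf G s ∪ orbitsOf G t := Set.image_union ..
  unfold mass
  rw [hu]
  exact ENNReal.summable.tsum_union_disjoint hd ENNReal.summable

@[simp]
theorem mass_orbit (y : Y) : mass G (orbit G y) = stabInv G y := by
  unfold mass
  rw [orbitsOf_orbit]
  simp

theorem mass_iUnion_orbit_le {ι : Type*} (t : Finset ι) (d : ι → Y) :
    mass G (⋃ i ∈ t, orbit G (d i)) ≤ t.card := by
  have hu : orbitsOf G (⋃ i ∈ t, orbit G (d i)) = ⋃ i ∈ t, orbitsOf G (orbit G (d i)) := by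
    unfold orbitsOf
    simp only [Set.image_iUnion]
  unfold mass
  rw [hu]
  refine (ENNReal.tsum_biUnion_le _ _ _).trans ?_
  calc ∑ i ∈ t, mass G (orbit G (d i)) ≤ ∑ i ∈ t, (1 : ℝ≥0∞) :=
        Finset.sum_le_sum fun i _ => by
          rw [mass_orbit]
          exact_mod_cast stabInv_le_one (d i)
    _ = t.card := by simp

theorem mass_ne_top {s : Set Y} (h : (orbitsOf G s).Finite) : mass G s ≠ ∞ := by
  have := h.to_subtype
  have := Fintype.ofFinite (orbitsOf G s)
  unfold mass
  rw [tsum_fintype]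
  refine ENNReal.sum_ne_top.2 fun x _ => ?_
  obtain ⟨_, y, _, rfl⟩ := x
  simp

/-- If the stabilizers of all elements of `s` have an order dividing `M`, then `M` times the mass
of `s` is a natural number. -/
theorem exists_nat_eq_mul_mass {s : Set Y} (h : (orbitsOf G s).Finite) {M : ℕ} (hM : M ≠ 0)
    (hd : ∀ y ∈ s, Nat.card (stabilizer G y) ∣ M) : ∃ k : ℕ, M * mass G s = k := by
  have := h.to_subtype
  have := Fintype.ofFinite (orbitsOf G s)
  have key : ∀ x : orbitsOf G s, ∃ k : ℕ, (M : ℝ≥0∞) * orbitWeight G x.1 = k := by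
    rintro ⟨_, y, hy, rfl⟩
    obtain ⟨k, hk⟩ := hd y hy
    have h0 : (Nat.card (stabilizer G y) : ℝ≥0) ≠ 0 := by
      intro h0
      have h0' : Nat.card (stabilizer G y) = 0 := by exact_mod_cast h0
      rw [h0', zero_mul] at hk
      exact hM hk
    refine ⟨k, ?_⟩
    rw [orbitWeight_mk, stabInv]
    have : (M : ℝ≥0) * (Nat.card (stabilizer G y) : ℝ≥0)⁻¹ = k := by
      rw [hk, Nat.cast_mul]
      field_simp
    exact_mod_cast congrArg ((↑) : ℝ≥0 → ℝ≥0∞) this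
  choose k hk using key
  refine ⟨∑ x, k x, ?_⟩
  unfold mass
  rw [tsum_fintype, Finset.mul_sum, Nat.cast_sum]
  exact Finset.sum_congr rfl fun x _ => hk x

theorem stabilizer_le_of_equivariant {f : Y → Z} (hf : ∀ (g : G) y, f (g • y) = g • f y) (y : Y) :
    stabilizer G y ≤ stabilizer G (f y) := by
  intro g hg
  rw [mem_stabilizer_iff] at hg ⊢
  rw [← hf, hg]

theorem inv_card_le_inv_card {K L : Subgroup G} (h : K ≤ L) [Finite K] :
    ((Nat.card L : ℝ≥0))⁻¹ ≤ ((Nat.card K : ℝ≥0))⁻¹ := by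
  rcases Nat.eq_zero_or_pos (Nat.card L) with h0 | h0
  · simp [h0]
  · have hK : 0 < Nat.card K := Nat.card_pos
    have : Finite L := Nat.finite_of_card_ne_zero h0.ne'
    exact inv_anti₀ (by exact_mod_cast hK)
      (by exact_mod_cast Nat.card_le_card_of_injective _ (Subgroup.inclusion_injective h))

/-- A finite subgroup is either everything or at most half of a group that contains it. -/
theorem eq_or_two_mul_inv_card_le {K L : Subgroup G} (h : K ≤ L) [Finite K] :
    K = L ∨ 2 * ((Nat.card L : ℝ≥0))⁻¹ ≤ ((Nat.card K : ℝ≥0))⁻¹ := by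
  by_cases hL : Finite L
  · obtain ⟨m, hm⟩ := Subgroup.card_dvd_of_le h
    have hK : 0 < Nat.card K := Nat.card_pos
    have hL0 : 0 < Nat.card L := Nat.card_pos
    by_cases h1 : m = 1
    · left
      exact Subgroup.eq_of_le_of_card_ge h (by rw [hm, h1, mul_one])
    · right
      have hm0 : m ≠ 0 := by
        rintro rfl
        omega
      have h2 : 2 ≤ m := by omega
      have hle : Nat.card K * 2 ≤ Nat.card L := hm ▸ Nat.mul_le_mul_left _ h2
      have hle' : (Nat.card K : ℝ≥0) * 2 ≤ Nat.card L := by exact_mod_cast hle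
      have hKp : (0 : ℝ≥0) < Nat.card K := by exact_mod_cast hK
      have := inv_anti₀ (by positivity) hle'
      calc 2 * ((Nat.card L : ℝ≥0))⁻¹ ≤ 2 * ((Nat.card K : ℝ≥0) * 2)⁻¹ := by gcongr
        _ = ((Nat.card K : ℝ≥0))⁻¹ := by field_simp
  · right
    have : Infinite L := not_finite_iff_infinite.1 hL
    simp

theorem stabInv_le_of_le {y : Y} {z : Z} (h : stabilizer G y ≤ stabilizer G z)
    [Finite (stabilizer G y)] : stabInv G z ≤ stabInv G y :=
  inv_card_le_inv_card h

theorem stabInv_congr {y : Y} {z : Z} (h : stabilizer G y = stabilizer G z) :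
    stabInv G y = stabInv G z := by
  rw [stabInv, stabInv, h]

/-- Comparison of masses through an injective map between the sets of orbits. -/
theorem mass_le_of_orbit_injection {s : Set Y} {t : Set Z} (f : Y → Z)
    (hw : ∀ y ∈ s, ∃ z ∈ t, (∃ g : G, g • f y = z) ∧ stabInv G y ≤ stabInv G z)
    (hinj : ∀ y ∈ s, ∀ y' ∈ s, (∃ g : G, g • f y = f y') → ∃ g : G, g • y = y') :
    mass G s ≤ mass G t := by
  rcases isEmpty_or_nonempty Y with h | ⟨⟨y₀⟩⟩
  · rw [Set.eq_empty_of_isEmpty s]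
    simp [mass, orbitsOf]
  have : Nonempty Z := ⟨f y₀⟩
  have key : ∀ x : orbitsOf G s, ∃ y ∈ s, Quotient.mk (orbitRel G Y) y = x.1 := fun x => x.2
  choose r hr hrx using key
  choose! z hz hg hle using hw
  have hmem : ∀ x : orbitsOf G s, Quotient.mk (orbitRel G Z) (z (r x)) ∈ orbitsOf G t :=
    fun x => ⟨_, hz _ (hr x), rfl⟩
  let F : orbitsOf G s → orbitsOf G t := fun x => ⟨_, hmem x⟩
  have hF : Function.Injective F := by
    intro x x' h
    obtain ⟨g, h1⟩ := mk_eq_mk_iff.1 (congrArg Subtype.val h)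
    obtain ⟨a, ha⟩ := hg _ (hr x)
    obtain ⟨b, hb⟩ := hg _ (hr x')
    have h2 : (a⁻¹ * (g * b)) • f (r x') = f (r x) := by
      rw [mul_smul, mul_smul, hb, h1, ← ha, inv_smul_smul]
    obtain ⟨k, hk⟩ := hinj _ (hr x') _ (hr x) ⟨_, h2⟩
    apply Subtype.ext
    rw [← hrx x, ← hrx x']
    exact mk_eq_mk_iff.2 ⟨k, hk⟩
  calc mass G s = ∑' x : orbitsOf G s, (stabInv G (r x) : ℝ≥0∞) :=
        tsum_congr fun x => by rw [← hrx x, orbitWeight_mk]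
    _ ≤ ∑' x : orbitsOf G s, orbitWeight G (F x).1 :=
        ENNReal.tsum_le_tsum fun x => ENNReal.coe_le_coe.2 (hle _ (hr x))
    _ ≤ mass G t := ENNReal.tsum_comp_le_tsum_of_injective hF fun x => orbitWeight G x.1

/-- An equivariant image has at most the mass of the set, as stabilizers only grow. -/
theorem mass_image_le {s : Set Y} {f : Y → Z} (hf : ∀ (g : G) y, f (g • y) = g • f y)
    (hfin : ∀ y ∈ s, Finite (stabilizer G y)) : mass G (f '' s) ≤ mass G s := by
  rcases isEmpty_or_nonempty Y with h | h
  · rw [Set.eq_empty_of_isEmpty s]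
    simp [mass, orbitsOf]
  have key : ∀ z : Z, z ∈ f '' s → ∃ y ∈ s, f y = z := fun z hz => hz
  choose! r hr hrz using key
  refine mass_le_of_orbit_injection r (fun z hz => ⟨r z, hr z hz, ⟨1, one_smul _ _⟩, ?_⟩) ?_
  · have := hfin _ (hr z hz)
    have h1 := stabilizer_le_of_equivariant hf (r z)
    rw [hrz z hz] at h1
    exact stabInv_le_of_le h1
  · rintro z hz z' hz' ⟨g, hg⟩
    exact ⟨g, by rw [← hrz z hz, ← hf, hg, hrz z' hz']⟩

theorem stabilizer_eq_of_injOn {s : Set Y} (hs : IsStable G s) {f : Y → Z}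
    (hf : ∀ (g : G) y, f (g • y) = g • f y) (hinj : Set.InjOn f s) {y : Y} (hy : y ∈ s) :
    stabilizer G (f y) = stabilizer G y := by
  refine le_antisymm (fun g hg => ?_) (stabilizer_le_of_equivariant hf y)
  rw [mem_stabilizer_iff] at hg ⊢
  exact hinj (hs g y hy) hy (by rw [hf, hg])

theorem mass_image_of_injOn {s : Set Y} (hs : IsStable G s) {f : Y → Z}
    (hf : ∀ (g : G) y, f (g • y) = g • f y) (hinj : Set.InjOn f s) :
    mass G (f '' s) = mass G s := by
  apply le_antisymm
  · rcases isEmpty_or_nonempty Y with h | h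
    · rw [Set.eq_empty_of_isEmpty s]
      simp [mass, orbitsOf]
    have key : ∀ z : Z, z ∈ f '' s → ∃ y ∈ s, f y = z := fun z hz => hz
    choose! r hr hrz using key
    refine mass_le_of_orbit_injection r (fun z hz => ⟨r z, hr z hz, ⟨1, one_smul _ _⟩, ?_⟩) ?_
    · have h1 := stabilizer_eq_of_injOn hs hf hinj (hr z hz)
      rw [hrz z hz] at h1
      exact (stabInv_congr h1).le
    · rintro z hz z' hz' ⟨g, hg⟩
      exact ⟨g, by rw [← hrz z hz, ← hf, hg, hrz z' hz']⟩
  · refine mass_le_of_orbit_injection f (fun y hy => ⟨f y, ⟨y, hy, rfl⟩, ⟨1, one_smul _ _⟩, ?_⟩) ?_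
    · exact (stabInv_congr (stabilizer_eq_of_injOn hs hf hinj hy)).ge
    · rintro y hy y' hy' ⟨g, hg⟩
      exact ⟨g, hinj (hs g y hy) hy' (by rw [hf, hg])⟩

theorem finite_orbitsOf_image {s : Set Y} {f : Y → Z} (hf : ∀ (g : G) y, f (g • y) = g • f y)
    (h : (orbitsOf G s).Finite) : (orbitsOf G (f '' s)).Finite := by
  let F : orbitRel.Quotient G Y → orbitRel.Quotient G Z :=
    Quotient.map f (by
      rintro a b ⟨g, rfl⟩
      exact ⟨g, (hf g b).symm⟩)
  refine (h.image F).subset ?_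
  rintro _ ⟨_, ⟨y, hy, rfl⟩, rfl⟩
  exact ⟨_, ⟨y, hy, rfl⟩, rfl⟩

theorem mem_stabilizer_prod {x : Y} {y : Z} {g : G} :
    g ∈ stabilizer G (x, y) ↔ g • x = x ∧ g • y = y := by
  rw [mem_stabilizer_iff, Prod.smul_mk, Prod.mk.injEq]

theorem stabilizer_mk_eq (x : Y) (y : Z) :
    stabilizer G (x, y) = stabilizer G x ⊓ stabilizer G y := by
  ext g
  rw [mem_stabilizer_prod]
  rfl

/-- Splitting an orbit off an invariant set. -/
theorem mass_eq_diff_orbit_add {s : Set Y} (hs : IsStable G s) {y : Y} (hy : y ∈ s) :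
    mass G s = mass G (s \ orbit G y) + stabInv G y := by
  have hsub : orbit G y ⊆ s := by
    rintro _ ⟨g, rfl⟩
    exact hs g y hy
  rw [← mass_orbit, ← mass_union (hs.diff (isStable_orbit y)) (isStable_orbit y)
    Set.disjoint_sdiff_left, Set.sdiff_union_of_subset hsub]

end OrbitMass

/-! ### Equivariant identification of two points -/

section Gluing

variable {G : Type*} [Group G] {W V : Type*} [MulAction G W] [MulAction G V]

/-- The subgroup generated by the elements that carry a point of `{a, b}` to a point of `{a, b}`. It
is the stabilizer of the common image of `a` and `b` after these two points are identified
equivariantly. -/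
def glueGroup (G : Type*) [Group G] {W : Type*} [MulAction G W] (a b : W) : Subgroup G :=
  Subgroup.closure {g | ∃ p ∈ ({a, b} : Set W), g • p ∈ ({a, b} : Set W)}

theorem stabilizer_left_le_glueGroup (a b : W) : stabilizer G a ≤ glueGroup G a b :=
  fun _ hg => Subgroup.subset_closure ⟨a, Or.inl rfl, Or.inl hg⟩

theorem stabilizer_right_le_glueGroup (a b : W) : stabilizer G b ≤ glueGroup G a b :=
  fun _ hg => Subgroup.subset_closure ⟨b, Or.inr rfl, Or.inr hg⟩

theorem mem_glueGroup {a b p q : W} {g : G} (hp : p ∈ ({a, b} : Set W))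
    (hq : q ∈ ({a, b} : Set W)) (h : g • p = q) : g ∈ glueGroup G a b :=
  Subgroup.subset_closure ⟨p, hp, h ▸ hq⟩

theorem glueGroup_le {a b : W} {L : Subgroup G} (ha : stabilizer G a ≤ L)
    (hb : stabilizer G b ≤ L) (hab : ∀ k : G, k • a = b → k ∈ L) : glueGroup G a b ≤ L := by
  refine (Subgroup.closure_le L).2 ?_
  rintro g ⟨p, rfl | rfl, hq | hq⟩
  · exact ha hq
  · exact hab g hq
  · exact inv_mem_iff.1 (hab g⁻¹ (by rw [← Set.mem_singleton_iff.1 hq, inv_smul_smul]))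
  · exact hb hq

/-- The finest `G`-stable equivalence relation that identifies `a` and `b`, in explicit form. -/
def glueSetoid (G : Type*) [Group G] {W : Type*} [MulAction G W] (a b : W) : Setoid W where
  r x y := x = y ∨ ∃ g : G, ∃ h ∈ glueGroup G a b, ∃ p ∈ ({a, b} : Set W),
    ∃ q ∈ ({a, b} : Set W), x = g • p ∧ y = (g * h) • q
  iseqv :=
    { refl := fun _ => Or.inl rfl
      symm := by
        rintro x y (rfl | ⟨g, h, hh, p, hp, q, hq, rfl, rfl⟩)
        · exact Or.inl rfl
        · exact Or.inr ⟨g * h, h⁻¹, inv_mem hh, q, hq, p, hp, rfl, by simp⟩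
      trans := by
        rintro x y z (rfl | ⟨g, h, hh, p, hp, q, hq, rfl, rfl⟩) hyz
        · exact hyz
        · rcases hyz with rfl | ⟨g', h', hh', p', hp', q', hq', h1, rfl⟩
          · exact Or.inr ⟨g, h, hh, p, hp, q, hq, rfl, rfl⟩
          · have hk : g'⁻¹ * (g * h) ∈ glueGroup G a b :=
              mem_glueGroup hq hp' (by rw [mul_smul, h1, inv_smul_smul])
            refine Or.inr ⟨g, h * (g'⁻¹ * (g * h))⁻¹ * h',
              mul_mem (mul_mem hh (inv_mem hk)) hh', p, hp, q', hq', rfl, ?_⟩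
            congr 1
            group }

/-- The quotient of the `G`-set `W` in which the points `a` and `b` are identified equivariantly. -/
def Glue (G : Type*) [Group G] {W : Type*} [MulAction G W] (a b : W) : Type _ :=
  Quotient (glueSetoid G a b)

namespace Glue

/-- The projection to the quotient. -/
def mk (G : Type*) [Group G] {W : Type*} [MulAction G W] (a b : W) (x : W) : Glue G a b :=
  Quotient.mk (glueSetoid G a b) x

instance (a b : W) : MulAction G (Glue G a b) where
  smul g := Quotient.map (fun x => g • x) (by
    rintro x y (rfl | ⟨k, h, hh, p, hp, q, hq, rfl, rfl⟩)
    · exact Or.inl rfl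
    · exact Or.inr ⟨g * k, h, hh, p, hp, q, hq, by rw [mul_smul], by
        rw [← mul_smul, mul_assoc]⟩)
  one_smul := by
    intro x
    induction x using Quotient.ind with
    | _ x => exact congrArg (Quotient.mk _) (one_smul G x)
  mul_smul := by
    intro g h x
    induction x using Quotient.ind with
    | _ x => exact congrArg (Quotient.mk _) (mul_smul g h x)

variable {a b : W}

theorem mk_smul (g : G) (x : W) : mk G a b (g • x) = g • mk G a b x := rfl

theorem mk_surjective : Function.Surjective (mk G a b) := Quotient.mk_surjective

theorem mk_eq_mk_iff {x y : W} : mk G a b x = mk G a b y ↔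
    x = y ∨ ∃ g : G, ∃ h ∈ glueGroup G a b, ∃ p ∈ ({a, b} : Set W),
      ∃ q ∈ ({a, b} : Set W), x = g • p ∧ y = (g * h) • q :=
  ⟨fun h => Quotient.exact h, fun h => Quotient.sound h⟩

variable (G a b) in
theorem mk_left_eq_mk_right : mk G a b a = mk G a b b :=
  mk_eq_mk_iff.2 (Or.inr ⟨1, 1, one_mem _, a, Or.inl rfl, b, Or.inr rfl, by simp, by simp⟩)

theorem eq_of_mk_eq_mk {x y : W} (ha : x ∉ orbit G a) (hb : x ∉ orbit G b)
    (h : mk G a b x = mk G a b y) : x = y := by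
  rcases mk_eq_mk_iff.1 h with h | ⟨g, _, _, p, rfl | rfl, _, _, rfl, _⟩
  · exact h
  · exact absurd (mem_orbit _ g) ha
  · exact absurd (mem_orbit _ g) hb

variable (G a b) in
theorem stabilizer_mk_left : stabilizer G (mk G a b a) = glueGroup G a b := by
  ext k
  rw [mem_stabilizer_iff, ← mk_smul, mk_eq_mk_iff]
  constructor
  · rintro (h | ⟨g, h, hh, p, hp, q, hq, h1, h2⟩)
    · exact stabilizer_left_le_glueGroup a b h
    · have e1 : g⁻¹ * k ∈ glueGroup G a b :=
        mem_glueGroup (Or.inl rfl) hp (by rw [mul_smul, h1, inv_smul_smul])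
      have e2 : g * h ∈ glueGroup G a b := mem_glueGroup hq (Or.inl rfl) h2.symm
      have e3 := mul_mem (mul_mem e2 (inv_mem hh)) e1
      simpa using e3
  · intro h
    exact Or.inr ⟨k, k⁻¹, inv_mem h, a, Or.inl rfl, a, Or.inl rfl, rfl, by simp⟩

theorem stabilizer_mk_of_notMem {x : W} (ha : x ∉ orbit G a) (hb : x ∉ orbit G b) :
    stabilizer G (mk G a b x) = stabilizer G x := by
  refine le_antisymm (fun g hg => ?_) (stabilizer_le_of_equivariant mk_smul x)
  rw [mem_stabilizer_iff, ← mk_smul] at hg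
  exact (eq_of_mk_eq_mk ha hb hg.symm).symm

theorem mk_mem_orbit_iff {x : W} :
    mk G a b x ∈ orbit G (mk G a b a) ↔ x ∈ orbit G a ∪ orbit G b := by
  constructor
  · rintro ⟨g, hg⟩
    rcases mk_eq_mk_iff.1 (show mk G a b (g • a) = mk G a b x from hg) with
      h | ⟨k, h, _, _, _, q, rfl | rfl, _, rfl⟩
    · exact Or.inl ⟨g, h⟩
    · exact Or.inl (mem_orbit _ _)
    · exact Or.inr (mem_orbit _ _)
  · rintro (⟨g, rfl⟩ | ⟨g, rfl⟩)
    · exact ⟨g, rfl⟩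
    · exact ⟨g, by
        change g • mk G a b a = g • mk G a b b
        rw [mk_left_eq_mk_right]⟩

/-- An equivariant map with `f a = f b` factors through the quotient. -/
def lift {f : W → V} (hf : ∀ (g : G) x, f (g • x) = g • f x) (hab : f a = f b) :
    Glue G a b → V :=
  Quotient.lift f (by
    have hst : ∀ p ∈ ({a, b} : Set W), f p = f a := by
      rintro p (rfl | rfl)
      · rfl
      · exact hab.symm
    have hH : glueGroup G a b ≤ stabilizer G (f a) := by
      refine (Subgroup.closure_le _).2 ?_
      rintro g ⟨p, hp, hq⟩
      change g • f a = f a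
      rw [← hst p hp, ← hf, hst _ hq, hst p hp]
    rintro x y (rfl | ⟨g, h, hh, p, hp, q, hq, rfl, rfl⟩)
    · rfl
    · rw [hf, hf, hst p hp, hst q hq, mul_smul, show h • f a = f a from hH hh])

theorem lift_mk {f : W → V} (hf : ∀ (g : G) x, f (g • x) = g • f x) (hab : f a = f b) (x : W) :
    lift hf hab (mk G a b x) = f x := rfl

theorem lift_smul {f : W → V} (hf : ∀ (g : G) x, f (g • x) = g • f x) (hab : f a = f b) (g : G)
    (x : Glue G a b) : lift hf hab (g • x) = g • lift hf hab x := by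
  obtain ⟨x, rfl⟩ := mk_surjective x
  rw [← mk_smul, lift_mk, lift_mk, hf]

end Glue

end Gluing

/-! ### Graphs over a `G`-set and their bounds -/

section Resolution

open scoped NNReal

variable {G : Type*} [Group G] {W V : Type*} [MulAction G W] [MulAction G V]

/-- `StabArrow G E x y`: the points `x` and `y` are joined by an edge of `E` and the stabilizer of
`x` is contained in that of `y`. Such an edge has the same stabilizer as `x`; it is the kind of
edge along which `x` can be compressed into `y`. -/
def StabArrow (G : Type*) [Group G] {W : Type*} [MulAction G W] (E : Set (W × W)) (x y : W) :
    Prop :=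
  ((x, y) ∈ E ∨ (y, x) ∈ E) ∧ stabilizer G x ≤ stabilizer G y

/-- Every point of `W` can be joined to a point of `R` by a path of `StabArrow`s. -/
def Dominates (G : Type*) [Group G] {W : Type*} [MulAction G W] (E : Set (W × W)) (R : Set W) :
    Prop :=
  ∀ w : W, ∃ r ∈ R, Relation.ReflTransGen (StabArrow G E) w r

/-- A `G`-graph with vertex set `W` and set of oriented edges `E`, mapped equivariantly by `φ` to
`V` such that edges go to pairs in `D`, together with a dominating set `R` of vertices for which the
bound `mass E - mass (W \ R) ≤ n` holds (written without subtraction). One can think of `W \ R` as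
the set of the vertices that are compressed. -/
structure IsResolution (G : Type*) [Group G] {W V : Type*} [MulAction G W] [MulAction G V]
    (D : Set (V × V)) (n : ℝ≥0) (φ : W → V) (E : Set (W × W)) (R : Set W) : Prop where
  map_smul : ∀ (g : G) x, φ (g • x) = g • φ x
  stable_edges : IsStable G E
  stable_roots : IsStable G R
  map_mem : ∀ e ∈ E, Prod.map φ φ e ∈ D
  finite_vertices : (orbitsOf G (Set.univ : Set W)).Finite
  finite_edges : (orbitsOf G E).Finite
  dominates : Dominates G E R
  bound : mass G E + mass G R ≤ n + mass G (Set.univ : Set W)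

theorem prodMap_smul {f : W → V} (hf : ∀ (g : G) x, f (g • x) = g • f x) (g : G) (e : W × W) :
    Prod.map f f (g • e) = g • Prod.map f f e :=
  Prod.ext (hf g e.1) (hf g e.2)

theorem smul_le_stabilizer_smul {x y : W} {L : Subgroup G} (h : stabilizer G x ≤ L)
    (hL : L ≤ stabilizer G y) (g : G) : stabilizer G (g • x) ≤ stabilizer G (g • y) := by
  intro k hk
  rw [mem_stabilizer_iff] at hk ⊢
  have h1 : g⁻¹ * k * g ∈ stabilizer G x := by
    rw [mem_stabilizer_iff, mul_smul, mul_smul, hk, inv_smul_smul]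
  have h2 := hL (h h1)
  rw [mem_stabilizer_iff, mul_smul, mul_smul, inv_smul_eq_iff] at h2
  exact h2

theorem StabArrow.smul {E : Set (W × W)} (hE : IsStable G E) {x y : W} (h : StabArrow G E x y)
    (g : G) : StabArrow G E (g • x) (g • y) :=
  ⟨h.1.imp (hE g _) (hE g _), smul_le_stabilizer_smul h.2 le_rfl g⟩

theorem reflTransGen_stabArrow_smul {E : Set (W × W)} (hE : IsStable G E) {x y : W}
    (h : Relation.ReflTransGen (StabArrow G E) x y) (g : G) :
    Relation.ReflTransGen (StabArrow G E) (g • x) (g • y) :=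
  h.lift _ fun _ _ h' => h'.smul hE g

theorem stabilizer_le_of_reflTransGen {E : Set (W × W)} {x y : W}
    (h : Relation.ReflTransGen (StabArrow G E) x y) : stabilizer G x ≤ stabilizer G y := by
  induction h with
  | refl => exact le_rfl
  | tail _ h ih => exact ih.trans h.2

section Glue

variable {a b : W}

/-- The image of a set of edges in the quotient by the identification of `a` and `b`. -/
def glueEdges (G : Type*) [Group G] {W : Type*} [MulAction G W] (a b : W) (E : Set (W × W)) :
    Set (Glue G a b × Glue G a b) :=
  Prod.map (Glue.mk G a b) (Glue.mk G a b) '' E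

theorem StabArrow.mk {E : Set (W × W)} {x y : W} (h : StabArrow G E x y)
    (hx : x ∉ orbit G a ∪ orbit G b) :
    StabArrow G (glueEdges G a b E) (Glue.mk G a b x) (Glue.mk G a b y) := by
  refine ⟨h.1.imp (fun h => ⟨_, h, rfl⟩) (fun h => ⟨_, h, rfl⟩), ?_⟩
  rw [Glue.stabilizer_mk_of_notMem (fun h => hx (Or.inl h)) (fun h => hx (Or.inr h))]
  exact h.2.trans (stabilizer_le_of_equivariant Glue.mk_smul y)

theorem stable_glueEdges {E : Set (W × W)} (hE : IsStable G E) :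
    IsStable G (glueEdges G a b E) :=
  hE.image (prodMap_smul Glue.mk_smul)

theorem dominates_glue {E : Set (W × W)} {R : Set W} (hE : IsStable G E) (h : Dominates G E R)
    {R' : Set (Glue G a b)} (hR' : IsStable G R') (hsub : Glue.mk G a b '' R ⊆ R')
    (ha : ∃ r ∈ R', Relation.ReflTransGen (StabArrow G (glueEdges G a b E)) (Glue.mk G a b a) r) :
    Dominates G (glueEdges G a b E) R' := by
  have horb : ∀ x ∈ orbit G a ∪ orbit G b,
      ∃ r ∈ R', Relation.ReflTransGen (StabArrow G (glueEdges G a b E)) (Glue.mk G a b x) r := by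
    intro x hx
    obtain ⟨g, hg⟩ := Glue.mk_mem_orbit_iff.2 hx
    obtain ⟨r, hr, h⟩ := ha
    refine ⟨g • r, hR' g r hr, ?_⟩
    rw [← hg]
    exact reflTransGen_stabArrow_smul (stable_glueEdges hE) h g
  intro x
  obtain ⟨x, rfl⟩ := Glue.mk_surjective x
  obtain ⟨r, hr, hp⟩ := h x
  induction hp using Relation.ReflTransGen.head_induction_on with
  | refl => exact ⟨_, hsub ⟨r, hr, rfl⟩, .refl⟩
  | @head x y hxy _ ih =>
    by_cases hx : x ∈ orbit G a ∪ orbit G b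
    · exact horb x hx
    · obtain ⟨r', hr', hp'⟩ := ih
      exact ⟨r', hr', .head (hxy.mk hx) hp'⟩

/-- If the stabilizer `H` of the glued point is contained in the stabilizer of `z`, and each of the
stabilizers of `a` and `b` is finite or equal to `H`, then a path from `z` to a root survives in the
quotient: whenever it passes through the orbit of `a` or `b`, the stabilizer has not grown. -/
theorem exists_reflTransGen_mk_of_glueGroup_le {E : Set (W × W)} {R : Set W}
    (h : Dominates G E R) {z : W}
    (hz : glueGroup G a b ≤ stabilizer G z)
    (ha : Finite (stabilizer G a) ∨ glueGroup G a b ≤ stabilizer G a)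
    (hb : Finite (stabilizer G b) ∨ glueGroup G a b ≤ stabilizer G b) :
    ∃ r ∈ Glue.mk G a b '' R,
      Relation.ReflTransGen (StabArrow G (glueEdges G a b E)) (Glue.mk G a b z) r := by
  obtain ⟨r, hr, hp⟩ := h z
  have key : ∀ x, Relation.ReflTransGen (StabArrow G E) x r →
      Relation.ReflTransGen (StabArrow G E) z x →
      ∃ r ∈ Glue.mk G a b '' R,
        Relation.ReflTransGen (StabArrow G (glueEdges G a b E)) (Glue.mk G a b x) r := by
    intro x hx
    induction hx using Relation.ReflTransGen.head_induction_on with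
    | refl => exact fun _ => ⟨_, ⟨r, hr, rfl⟩, .refl⟩
    | @head x y hxy _ ih =>
      intro hzx
      obtain ⟨r', hr', hp'⟩ := ih (hzx.tail hxy)
      refine ⟨r', hr', .head ?_ hp'⟩
      by_cases hx : x ∈ orbit G a ∪ orbit G b
      · have hzx' := stabilizer_le_of_reflTransGen hzx
        have main : ∀ p ∈ ({a, b} : Set W), stabilizer G p ≤ glueGroup G a b →
            (Finite (stabilizer G p) ∨ glueGroup G a b ≤ stabilizer G p) → x ∈ orbit G p →
            StabArrow G (glueEdges G a b E) (Glue.mk G a b x) (Glue.mk G a b y) := by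
          rintro p hp hpH hfin ⟨g, rfl⟩
          have hH : glueGroup G a b ≤ stabilizer G p := by
            rcases hfin with hfin | hH
            · have hcard : Nat.card (stabilizer G (g • p)) = Nat.card (stabilizer G p) :=
                card_stabilizer_smul g p
              have hf : Finite (stabilizer G (g • p)) :=
                Nat.finite_of_card_ne_zero (by rw [hcard]; exact Nat.card_pos.ne')
              have hle : Nat.card (glueGroup G a b) ≤ Nat.card (stabilizer G (g • p)) :=
                Subgroup.card_le_of_le (hz.trans hzx')
              have hfH : Finite (glueGroup G a b) :=
                Finite.of_injective _ (Subgroup.inclusion_injective (hz.trans hzx'))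
              rw [hcard] at hle
              exact (Subgroup.eq_of_le_of_card_ge hpH hle).ge
            · exact hH
          refine ⟨hxy.1.imp (fun h => ⟨_, h, rfl⟩) (fun h => ⟨_, h, rfl⟩), ?_⟩
          have hmk : Glue.mk G a b p = Glue.mk G a b a := by
            rcases hp with rfl | rfl
            · rfl
            · exact (Glue.mk_left_eq_mk_right G a p).symm
          have h2 : stabilizer G (g • p) ≤ stabilizer G y := hxy.2
          intro k hk
          have hk1 : g⁻¹ * k * g ∈ stabilizer G p := by
            apply hH
            rw [← Glue.stabilizer_mk_left, ← hmk, mem_stabilizer_iff, mul_smul, mul_smul,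
              ← Glue.mk_smul, inv_smul_eq_iff]
            exact hk
          have hk2 : k ∈ stabilizer G (g • p) := by
            rw [mem_stabilizer_iff, mul_smul, mul_smul, inv_smul_eq_iff] at hk1
            exact hk1
          exact stabilizer_le_of_equivariant Glue.mk_smul y (h2 hk2)
        rcases hx with hx | hx
        · exact main a (Or.inl rfl) (stabilizer_left_le_glueGroup a b) ha hx
        · exact main b (Or.inr rfl) (stabilizer_right_le_glueGroup a b) hb hx
      · exact hxy.mk hx
  exact key z hp .refl

theorem stable_orbit_union_orbit : IsStable G (orbit G a ∪ orbit G b) :=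
  (isStable_orbit a).union (isStable_orbit b)

theorem injOn_mk_diff (s : Set W) : Set.InjOn (Glue.mk G a b) (s \ (orbit G a ∪ orbit G b)) :=
  fun _ hx _ _ h => Glue.eq_of_mk_eq_mk (fun h => hx.2 (Or.inl h)) (fun h => hx.2 (Or.inr h)) h

theorem mass_univ_glue :
    mass G (Set.univ : Set (Glue G a b)) =
      mass G (Set.univ \ (orbit G a ∪ orbit G b)) + stabInv G (Glue.mk G a b a) := by
  rw [mass_eq_diff_orbit_add isStable_univ (Set.mem_univ (Glue.mk G a b a)),
    ← mass_image_of_injOn (isStable_univ.diff stable_orbit_union_orbit) Glue.mk_smul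
      (injOn_mk_diff _)]
  congr 2
  ext x
  obtain ⟨x, rfl⟩ := Glue.mk_surjective x
  constructor
  · rintro ⟨-, h⟩
    exact ⟨x, ⟨trivial, fun h' => h (Glue.mk_mem_orbit_iff.2 h')⟩, rfl⟩
  · rintro ⟨y, ⟨-, h⟩, hy⟩
    exact ⟨trivial, fun h' => h (by rw [← hy, Glue.mk_mem_orbit_iff] at h'; exact h')⟩

theorem add_le_add_of_exchange {e r w : ℝ≥0∞} {n c α ρ ω ε ρ' δ : ℝ≥0} (he : e ≠ ∞)
    (hr : r ≠ ∞) (hw : w ≠ ∞) (h : (e + α) + (r + ρ) ≤ n + (w + ω))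
    (hnum : ε + ρ' + ω ≤ δ + α + ρ + c) : (e + ε) + (r + ρ') ≤ (n + c : ℝ≥0) + (w + δ) := by
  lift e to ℝ≥0 using he
  lift r to ℝ≥0 using hr
  lift w to ℝ≥0 using hw
  have h' : (e + α) + (r + ρ) ≤ n + (w + ω) := by exact_mod_cast h
  have goal : (e + ε) + (r + ρ') ≤ (n + c) + (w + δ) := by
    rw [← NNReal.coe_le_coe] at h' hnum ⊢
    push_cast at h' hnum ⊢
    linarith
  exact_mod_cast goal

variable {D : Set (V × V)} {n : ℝ≥0} {φ : W → V} {E : Set (W × W)} {R : Set W}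

theorem IsResolution.glue (X : IsResolution G D n φ E R) (hab : φ a = φ b) {n' : ℝ≥0}
    {R' : Set (Glue G a b)} (hR' : IsStable G R') (hsub : Glue.mk G a b '' R ⊆ R')
    (ha : ∃ r ∈ R', Relation.ReflTransGen (StabArrow G (glueEdges G a b E)) (Glue.mk G a b a) r)
    (hbound : mass G (glueEdges G a b E) + mass G R' ≤
      n' + mass G (Set.univ : Set (Glue G a b))) :
    IsResolution G D n' (Glue.lift X.map_smul hab) (glueEdges G a b E) R' where
  map_smul := Glue.lift_smul X.map_smul hab
  stable_edges := stable_glueEdges X.stable_edges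
  stable_roots := hR'
  map_mem := by
    rintro _ ⟨e, he, rfl⟩
    exact X.map_mem e he
  finite_vertices := by
    have := finite_orbitsOf_image (f := Glue.mk G a b) Glue.mk_smul X.finite_vertices
    rwa [Set.image_univ, Glue.mk_surjective.range_eq] at this
  finite_edges := finite_orbitsOf_image (prodMap_smul Glue.mk_smul) X.finite_edges
  dominates := dominates_glue X.stable_edges X.dominates hR' hsub ha
  bound := hbound

/-- Gluing where the common image of `a` and `b` becomes a root. Here `α`, `ρ` and `ω` are the
masses of edges, roots and vertices that are lost, and `ε` is the mass of edges that is gained. -/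
theorem IsResolution.glue_root (X : IsResolution G D n φ E R) (hab : φ a = φ b)
    {e : ℝ≥0∞} {c α ρ ω ε : ℝ≥0} (hE' : mass G (glueEdges G a b E) ≤ e + ε)
    (hE : e + α ≤ mass G E)
    (hR : mass G (R \ (orbit G a ∪ orbit G b)) + ρ ≤ mass G R)
    (hW : mass G (Set.univ : Set W) ≤ mass G (Set.univ \ (orbit G a ∪ orbit G b)) + ω)
    (hnum : ε + ω ≤ α + ρ + c) :
    IsResolution G D (n + c) (Glue.lift X.map_smul hab) (glueEdges G a b E)
      (Glue.mk G a b '' R ∪ orbit G (Glue.mk G a b a)) := by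
  have fV := mass_ne_top X.finite_vertices
  have he : e ≠ ∞ :=
    ne_top_of_le_ne_top (mass_ne_top X.finite_edges) (le_self_add.trans hE)
  refine X.glue hab ((X.stable_roots.image Glue.mk_smul).union (isStable_orbit _))
    Set.subset_union_left ⟨_, Or.inr (mem_orbit_self _), .refl⟩ ?_
  have hsub : Glue.mk G a b '' R ∪ orbit G (Glue.mk G a b a) ⊆
      Glue.mk G a b '' (R \ (orbit G a ∪ orbit G b)) ∪ orbit G (Glue.mk G a b a) := by
    rintro _ (⟨x, hx, rfl⟩ | h)
    · by_cases hx' : x ∈ orbit G a ∪ orbit G b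
      · exact Or.inr (Glue.mk_mem_orbit_iff.2 hx')
      · exact Or.inl ⟨x, ⟨hx, hx'⟩, rfl⟩
    · exact Or.inr h
  have hR' : mass G (Glue.mk G a b '' R ∪ orbit G (Glue.mk G a b a)) ≤
      mass G (R \ (orbit G a ∪ orbit G b)) + stabInv G (Glue.mk G a b a) := by
    refine (mass_mono hsub).trans ((mass_union_le _ _).trans ?_)
    rw [mass_orbit, mass_image_of_injOn (X.stable_roots.diff stable_orbit_union_orbit)
      Glue.mk_smul (injOn_mk_diff _)]
  rw [mass_univ_glue]
  refine (add_le_add hE' hR').trans (add_le_add_of_exchange he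
    (ne_top_of_le_ne_top fV (mass_mono (Set.subset_univ _)))
    (ne_top_of_le_ne_top fV (mass_mono (Set.subset_univ _)))
    ((add_le_add hE hR).trans (X.bound.trans (add_le_add_right hW _))) ?_)
  rw [← NNReal.coe_le_coe] at hnum ⊢
  push_cast at hnum ⊢
  linarith

/-- Gluing where the common image of `a` and `b` does not become a root. -/
theorem IsResolution.glue_notRoot (X : IsResolution G D n φ E R) (hab : φ a = φ b)
    {e : ℝ≥0∞} {α ω ε : ℝ≥0} (hE' : mass G (glueEdges G a b E) ≤ e + ε)
    (hE : e + α ≤ mass G E) (ha : a ∉ R) (hb : b ∉ R)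
    (hW : mass G (Set.univ : Set W) ≤ mass G (Set.univ \ (orbit G a ∪ orbit G b)) + ω)
    (hnum : ε + ω ≤ stabInv G (Glue.mk G a b a) + α)
    (hdom : ∃ r ∈ Glue.mk G a b '' R,
      Relation.ReflTransGen (StabArrow G (glueEdges G a b E)) (Glue.mk G a b a) r) :
    IsResolution G D n (Glue.lift X.map_smul hab) (glueEdges G a b E) (Glue.mk G a b '' R) := by
  have fV := mass_ne_top X.finite_vertices
  have he : e ≠ ∞ :=
    ne_top_of_le_ne_top (mass_ne_top X.finite_edges) (le_self_add.trans hE)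
  have hRd : R \ (orbit G a ∪ orbit G b) = R := by
    refine Set.Subset.antisymm Set.sdiff_subset fun x hx => ⟨hx, ?_⟩
    rintro (⟨g, rfl⟩ | ⟨g, rfl⟩)
    · exact ha (X.stable_roots.smul_mem_iff.1 hx)
    · exact hb (X.stable_roots.smul_mem_iff.1 hx)
  refine X.glue hab (X.stable_roots.image Glue.mk_smul) le_rfl hdom ?_
  have hR' : mass G (Glue.mk G a b '' R) = mass G R :=
    mass_image_of_injOn X.stable_roots Glue.mk_smul (hRd ▸ injOn_mk_diff R)
  rw [mass_univ_glue, hR']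
  have fR : mass G R ≠ ∞ := ne_top_of_le_ne_top fV (mass_mono (Set.subset_univ _))
  have h := add_le_add_of_exchange (n := n) (c := 0) (α := α) (ρ := 0) (ω := ω) (ε := ε) (ρ' := 0)
    (δ := stabInv G (Glue.mk G a b a)) he fR
    (ne_top_of_le_ne_top fV (mass_mono (Set.subset_univ (Set.univ \ (orbit G a ∪ orbit G b)))))
    (by
      rw [ENNReal.coe_zero, add_zero]
      exact (add_le_add_left hE _).trans (X.bound.trans (add_le_add_right hW _)))
    (by simpa using hnum)
  simp only [ENNReal.coe_zero, add_zero] at h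
  exact (add_le_add_left hE' _).trans h

theorem mass_univ_le_diff_add :
    mass G (Set.univ : Set W) ≤ mass G (Set.univ \ (orbit G a ∪ orbit G b)) +
      (stabInv G a + stabInv G b : ℝ≥0) := by
  calc mass G (Set.univ : Set W)
      ≤ mass G ((Set.univ \ (orbit G a ∪ orbit G b)) ∪ (orbit G a ∪ orbit G b)) :=
        mass_mono fun x _ => by
          by_cases h : x ∈ orbit G a ∪ orbit G b
          · exact Or.inr h
          · exact Or.inl ⟨trivial, h⟩
    _ ≤ _ := by
        refine (mass_union_le _ _).trans (add_le_add_right ((mass_union_le _ _).trans ?_) _)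
        simp

theorem mass_univ_le_diff_add_of_mem_orbit (h : b ∈ orbit G a) :
    mass G (Set.univ : Set W) ≤ mass G (Set.univ \ (orbit G a ∪ orbit G b)) + stabInv G a := by
  calc mass G (Set.univ : Set W)
      ≤ mass G ((Set.univ \ (orbit G a ∪ orbit G b)) ∪ orbit G a) :=
        mass_mono fun x _ => by
          by_cases h' : x ∈ orbit G a
          · exact Or.inr h'
          · refine Or.inl ⟨trivial, ?_⟩
            rw [orbit_eq_iff.2 h, Set.union_self]
            exact h'
    _ ≤ _ := (mass_union_le _ _).trans (by simp)

theorem mass_diff_add_le {s t : Set W} (hs : IsStable G s) (ht : IsStable G t) {x : W}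
    (hx : x ∈ s) (hxt : x ∈ t) : mass G (s \ t) + stabInv G x ≤ mass G s := by
  rw [← mass_orbit, ← mass_union (hs.diff ht) (isStable_orbit x)]
  · apply mass_mono
    rintro y (h | ⟨g, rfl⟩)
    · exact h.1
    · exact hs g x hx
  · rw [Set.disjoint_left]
    rintro y h ⟨g, rfl⟩
    exact h.2 (ht g x hxt)

end Glue

end Resolution

/-! ### Folding -/

section Folding

open scoped NNReal

variable {G : Type*} [Group G] {W V : Type*} [MulAction G W] [MulAction G V]

/-- The pair `(u, v)` or the pair `(v, u)`, according to `s`. -/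
def orientedPair {X : Type*} (s : Bool) (u v : X) : X × X := if s then (u, v) else (v, u)

theorem map_orientedPair {X Y : Type*} (f : X → Y) (s : Bool) (u v : X) :
    Prod.map f f (orientedPair s u v) = orientedPair s (f u) (f v) := by
  cases s <;> rfl

theorem smul_orientedPair (g : G) (s : Bool) (u v : W) :
    g • orientedPair s u v = orientedPair s (g • u) (g • v) := by
  cases s <;> rfl

theorem orientedPair_inj {X : Type*} {s : Bool} {u v u' v' : X} :
    orientedPair s u v = orientedPair s u' v' ↔ u = u' ∧ v = v' := by
  cases s <;> simp [orientedPair, and_comm]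

theorem stabilizer_orientedPair (s : Bool) (u v : W) :
    stabilizer G (orientedPair s u v) = stabilizer G u ⊓ stabilizer G v := by
  cases s
  · exact (stabilizer_mk_eq v u).trans (inf_comm _ _)
  · exact stabilizer_mk_eq u v

theorem stabArrow_of_orientedPair {E : Set (W × W)} {s : Bool} {u v : W}
    (h : orientedPair s u v ∈ E) (hle : stabilizer G v ≤ stabilizer G u) : StabArrow G E v u := by
  cases s
  · exact ⟨Or.inl h, hle⟩
  · exact ⟨Or.inr h, hle⟩

variable {D : Set (V × V)} {n : ℝ≥0} {φ : W → V} {E : Set (W × W)} {R : Set W}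

theorem IsResolution.finite_stabilizer_edge (X : IsResolution G D n φ E R)
    (hD : ∀ d ∈ D, Finite (stabilizer G d)) {e : W × W} (he : e ∈ E) :
    Finite (stabilizer G e) := by
  have := hD _ (X.map_mem e he)
  exact Finite.of_injective _ (Subgroup.inclusion_injective
    (stabilizer_le_of_equivariant (prodMap_smul X.map_smul) e))

theorem stabInv_pos {Y : Type*} [MulAction G Y] {y : Y} (h : Finite (stabilizer G y)) :
    0 < stabInv G y :=
  inv_pos.2 (by exact_mod_cast Nat.card_pos)

/-- The case of `IsResolution.exists_fold` where the end points `a` and `b` of the two edges lie in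
different orbits. -/
theorem IsResolution.exists_fold_of_notMem_orbit (X : IsResolution G D n φ E R)
    (hD : ∀ d ∈ D, Finite (stabilizer G d)) {s : Bool} {u a b : W}
    (h1 : orientedPair s u a ∈ E) (h2 : orientedPair s u b ∈ E) (hab : φ a = φ b)
    (horb : b ∉ orbit G a) {e : ℝ≥0∞}
    (hE' : mass G (glueEdges G a b E) ≤
      e + stabInv G (orientedPair s (Glue.mk G a b u) (Glue.mk G a b a)))
    (hE : e + (stabInv G (orientedPair s u a) + stabInv G (orientedPair s u b) : ℝ≥0) ≤ mass G E) :
    ∃ R', IsResolution G D n (Glue.lift X.map_smul hab) (glueEdges G a b E) R' := by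
  have hs' := stabilizer_orientedPair (G := G) s (Glue.mk G a b u) (Glue.mk G a b a)
  rw [Glue.stabilizer_mk_left] at hs'
  have hs1 := stabilizer_orientedPair (G := G) s u a
  have hs2 := stabilizer_orientedPair (G := G) s u b
  have huu : stabilizer G u ≤ stabilizer G (Glue.mk G a b u) :=
    stabilizer_le_of_equivariant Glue.mk_smul u
  have hl1 : stabilizer G (orientedPair s u a) ≤
      stabilizer G (orientedPair s (Glue.mk G a b u) (Glue.mk G a b a)) := by
    rw [hs', hs1]
    exact inf_le_inf huu (stabilizer_left_le_glueGroup a b)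
  have hl2 : stabilizer G (orientedPair s u b) ≤
      stabilizer G (orientedPair s (Glue.mk G a b u) (Glue.mk G a b a)) := by
    rw [hs', hs2]
    exact inf_le_inf huu (stabilizer_right_le_glueGroup a b)
  have f1 := X.finite_stabilizer_edge hD h1
  have f2 := X.finite_stabilizer_edge hD h2
  have hla : stabilizer G (orientedPair s u a) ≤ stabilizer G a := hs1 ▸ inf_le_right
  have hlb : stabilizer G (orientedPair s u b) ≤ stabilizer G b := hs2 ▸ inf_le_right
  have nE1 := stabInv_le_of_le hl1
  have nE2 := stabInv_le_of_le hl2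
  have na := stabInv_le_of_le hla
  have nb := stabInv_le_of_le hlb
  have hH : ∀ L : Subgroup G, stabilizer G a ≤ L → stabilizer G b ≤ L → glueGroup G a b ≤ L :=
    fun L ha hb => glueGroup_le ha hb fun k hk => absurd ⟨k, hk⟩ horb
  have hmk := Glue.stabilizer_mk_left G a b
  have hunion := stable_orbit_union_orbit (G := G) (a := a) (b := b)
  set se' := stabInv G (orientedPair s (Glue.mk G a b u) (Glue.mk G a b a)) with hse'
  set s1 := stabInv G (orientedPair s u a) with hdef1
  set s2 := stabInv G (orientedPair s u b) with hdef2
  -- The glued point may always be made a root; the estimates below say when the bound survives.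
  have root : ∀ ρ : ℝ≥0, mass G (R \ (orbit G a ∪ orbit G b)) + ρ ≤ mass G R →
      se' + (stabInv G a + stabInv G b) ≤ s1 + s2 + ρ →
      ∃ R', IsResolution G D n (Glue.lift X.map_smul hab) (glueEdges G a b E) R' := by
    intro ρ hρ hnum
    have := X.glue_root hab (c := 0) (ρ := ρ) hE' hE hρ mass_univ_le_diff_add (by simpa using hnum)
    rw [add_zero] at this
    exact ⟨_, this⟩
  by_cases haR : a ∈ R
  · exact root _ (mass_diff_add_le X.stable_roots hunion haR (Or.inl (mem_orbit_self a))) (by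
      rw [← NNReal.coe_le_coe] at nE1 nb ⊢
      push_cast
      linarith)
  by_cases hbR : b ∈ R
  · exact root _ (mass_diff_add_le X.stable_roots hunion hbR (Or.inr (mem_orbit_self b))) (by
      rw [← NNReal.coe_le_coe] at nE2 na ⊢
      push_cast
      linarith)
  have root0 : se' + (stabInv G a + stabInv G b) ≤ s1 + s2 →
      ∃ R', IsResolution G D n (Glue.lift X.map_smul hab) (glueEdges G a b E) R' := fun h =>
    root 0 (by simpa using mass_mono Set.sdiff_subset) (by simpa using h)
  have notRoot : se' + (stabInv G a + stabInv G b) ≤ stabInv G (Glue.mk G a b a) + (s1 + s2) →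
      (∃ r ∈ Glue.mk G a b '' R,
        Relation.ReflTransGen (StabArrow G (glueEdges G a b E)) (Glue.mk G a b a) r) →
      ∃ R', IsResolution G D n (Glue.lift X.map_smul hab) (glueEdges G a b E) R' :=
    fun hnum hdom => ⟨_, X.glue_notRoot hab hE' hE haR hbR mass_univ_le_diff_add hnum hdom⟩
  rcases eq_or_two_mul_inv_card_le hla with ea | sa
  · rcases eq_or_two_mul_inv_card_le hlb with eb | sb
    · -- The stabilizers of `a` and `b` fix `u`, so the glued point can be compressed into `u`.
      have hau : stabilizer G a ≤ stabilizer G u := by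
        rw [← ea, hs1]
        exact inf_le_left
      have hbu : stabilizer G b ≤ stabilizer G u := by
        rw [← eb, hs2]
        exact inf_le_left
      have hHu := hH _ hau hbu
      have hle : stabilizer G (Glue.mk G a b a) ≤
          stabilizer G (orientedPair s (Glue.mk G a b u) (Glue.mk G a b a)) := by
        rw [hmk, hs']
        exact le_inf (hHu.trans huu) le_rfl
      have hfin : Finite (stabilizer G (Glue.mk G a b a)) := by
        have : Finite (stabilizer G (orientedPair s (Glue.mk G a b u) (Glue.mk G a b a))) := by
          have := hD _ (by
            have := X.map_mem _ h1
            rw [map_orientedPair] at this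
            exact this)
          exact Finite.of_injective _ (Subgroup.inclusion_injective
            (show stabilizer G (orientedPair s (Glue.mk G a b u) (Glue.mk G a b a)) ≤
              stabilizer G (orientedPair s (φ u) (φ a)) by
              have h := stabilizer_le_of_equivariant
                (prodMap_smul (Glue.lift_smul X.map_smul hab))
                (orientedPair s (Glue.mk G a b u) (Glue.mk G a b a))
              rw [map_orientedPair] at h
              exact h))
        exact Finite.of_injective _ (Subgroup.inclusion_injective hle)
      have n1 := stabInv_le_of_le hle
      refine notRoot ?_ ?_
      · rw [← NNReal.coe_le_coe] at na nb n1 ⊢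
        push_cast
        linarith
      · obtain ⟨r, hr, hp⟩ := exists_reflTransGen_mk_of_glueGroup_le X.dominates hHu
          (Or.inl (ea ▸ f1)) (Or.inl (eb ▸ f2))
        refine ⟨r, hr, .head (stabArrow_of_orientedPair (s := s) ⟨_, h1, map_orientedPair ..⟩ ?_) hp⟩
        rw [hmk]
        exact hHu.trans huu
    · rcases eq_or_two_mul_inv_card_le hl2 with e2 | t2
      · -- Here `stabilizer a ≤ stabilizer b`, so the glued point inherits the path of `b`.
        have hab' : stabilizer G a ≤ stabilizer G b := by
          rw [← ea]
          refine hl1.trans ?_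
          rw [← e2]
          exact hlb
        have hHb := hH _ hab' le_rfl
        have hHb' : stabilizer G (Glue.mk G a b a) = stabilizer G b := by
          rw [hmk]
          exact le_antisymm hHb (stabilizer_right_le_glueGroup a b)
        have n1 : stabInv G (Glue.mk G a b a) = stabInv G b := stabInv_congr hHb'
        have n2 : s2 = se' := stabInv_congr e2
        refine notRoot ?_ ?_
        · rw [n1, n2]
          rw [← NNReal.coe_le_coe] at na ⊢
          push_cast
          linarith
        · rw [Glue.mk_left_eq_mk_right]
          exact exists_reflTransGen_mk_of_glueGroup_le X.dominates hHb
            (Or.inl (ea ▸ f1)) (Or.inr hHb)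
      · have t2' : 2 * se' ≤ s2 := t2
        have sb' : 2 * stabInv G b ≤ s2 := sb
        refine root0 ?_
        rw [← NNReal.coe_le_coe] at t2' sb' na ⊢
        push_cast at t2' sb' ⊢
        linarith
  · rcases eq_or_two_mul_inv_card_le hlb with eb | sb
    · rcases eq_or_two_mul_inv_card_le hl1 with e1 | t1
      · have hba' : stabilizer G b ≤ stabilizer G a := by
          rw [← eb]
          refine hl2.trans ?_
          rw [← e1]
          exact hla
        have hHa := hH _ le_rfl hba'
        have hHa' : stabilizer G (Glue.mk G a b a) = stabilizer G a := by
          rw [hmk]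
          exact le_antisymm hHa (stabilizer_left_le_glueGroup a b)
        have n1 : stabInv G (Glue.mk G a b a) = stabInv G a := stabInv_congr hHa'
        have n2 : s1 = se' := stabInv_congr e1
        refine notRoot ?_ ?_
        · rw [n1, n2]
          rw [← NNReal.coe_le_coe] at nb ⊢
          push_cast
          linarith
        · exact exists_reflTransGen_mk_of_glueGroup_le X.dominates hHa
            (Or.inr hHa) (Or.inl (eb ▸ f2))
      · have t1' : 2 * se' ≤ s1 := t1
        have sa' : 2 * stabInv G a ≤ s1 := sa
        refine root0 ?_
        rw [← NNReal.coe_le_coe] at t1' sa' nb ⊢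
        push_cast at t1' sa' ⊢
        linarith
    · have sa' : 2 * stabInv G a ≤ s1 := sa
      have sb' : 2 * stabInv G b ≤ s2 := sb
      refine root0 ?_
      rw [← NNReal.coe_le_coe] at sa' sb' nE1 nE2 ⊢
      push_cast at sa' sb' ⊢
      linarith

theorem finite_stabilizer_of_mem_orbit {a b : W} (h : b ∈ orbit G a)
    (ha : Finite (stabilizer G a)) : Finite (stabilizer G b) := by
  obtain ⟨g, rfl⟩ := h
  exact Nat.finite_of_card_ne_zero (by
    rw [card_stabilizer_smul]
    exact Nat.card_pos.ne')

/-- The case of `IsResolution.exists_fold` where the two edges lie in the same orbit. -/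
theorem IsResolution.exists_fold_of_smul_eq (X : IsResolution G D n φ E R)
    (hD : ∀ d ∈ D, Finite (stabilizer G d)) {s : Bool} {u a b : W}
    (h1 : orientedPair s u a ∈ E) (hne : a ≠ b) (hab : φ a = φ b) {j : G} (hju : j • u = u)
    (hjab : j • a = b) {e : ℝ≥0∞}
    (hE' : mass G (glueEdges G a b E) ≤
      e + stabInv G (orientedPair s (Glue.mk G a b u) (Glue.mk G a b a)))
    (hE : e + stabInv G (orientedPair s u a) ≤ mass G E) :
    (∃ R', IsResolution G D n (Glue.lift X.map_smul hab) (glueEdges G a b E) R') ∧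
      2 * stabInv G (orientedPair s (Glue.mk G a b u) (Glue.mk G a b a)) ≤
        stabInv G (orientedPair s u a) := by
  have horb : b ∈ orbit G a := ⟨j, hjab⟩
  have hs' := stabilizer_orientedPair (G := G) s (Glue.mk G a b u) (Glue.mk G a b a)
  rw [Glue.stabilizer_mk_left] at hs'
  have hs1 := stabilizer_orientedPair (G := G) s u a
  have huu : stabilizer G u ≤ stabilizer G (Glue.mk G a b u) :=
    stabilizer_le_of_equivariant Glue.mk_smul u
  have hl1 : stabilizer G (orientedPair s u a) ≤
      stabilizer G (orientedPair s (Glue.mk G a b u) (Glue.mk G a b a)) := by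
    rw [hs', hs1]
    exact inf_le_inf huu (stabilizer_left_le_glueGroup a b)
  have f1 := X.finite_stabilizer_edge hD h1
  have hla : stabilizer G (orientedPair s u a) ≤ stabilizer G a := hs1 ▸ inf_le_right
  have na := stabInv_le_of_le hla
  have hmk := Glue.stabilizer_mk_left G a b
  have hunion := stable_orbit_union_orbit (G := G) (a := a) (b := b)
  have hW := mass_univ_le_diff_add_of_mem_orbit horb
  set se' := stabInv G (orientedPair s (Glue.mk G a b u) (Glue.mk G a b a)) with hse'
  set s1 := stabInv G (orientedPair s u a) with hdef1
  -- The element `j` fixes the image of the edge, but not the edge itself.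
  have t1 : 2 * se' ≤ s1 := by
    rcases eq_or_two_mul_inv_card_le hl1 with e1 | t1
    · exfalso
      have hj : j ∈ stabilizer G (orientedPair s (Glue.mk G a b u) (Glue.mk G a b a)) := by
        rw [hs']
        exact ⟨huu hju, mem_glueGroup (Or.inl rfl) (Or.inr rfl) hjab⟩
      rw [← e1] at hj
      exact hne ((show j • a = a from hla hj).symm.trans hjab)
    · exact t1
  refine ⟨?_, t1⟩
  have root : ∀ ρ : ℝ≥0, mass G (R \ (orbit G a ∪ orbit G b)) + ρ ≤ mass G R →
      se' + stabInv G a ≤ s1 + ρ →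
      ∃ R', IsResolution G D n (Glue.lift X.map_smul hab) (glueEdges G a b E) R' := by
    intro ρ hρ hnum
    have := X.glue_root hab (c := 0) (ρ := ρ) hE' hE hρ hW (by simpa using hnum)
    rw [add_zero] at this
    exact ⟨_, this⟩
  by_cases haR : a ∈ R
  · exact root _ (mass_diff_add_le X.stable_roots hunion haR (Or.inl (mem_orbit_self a))) (by
      rw [← NNReal.coe_le_coe] at t1 ⊢
      push_cast at t1 ⊢
      linarith [se'.coe_nonneg])
  have hbR : b ∉ R := fun h => haR (X.stable_roots.smul_mem_iff.1 (hjab ▸ h))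
  rcases eq_or_two_mul_inv_card_le hla with ea | sa
  · have hau : stabilizer G a ≤ stabilizer G u := by
      rw [← ea, hs1]
      exact inf_le_left
    have hHu : glueGroup G a b ≤ stabilizer G u := by
      refine glueGroup_le hau ?_ fun k hk => ?_
      · have := smul_le_stabilizer_smul le_rfl hau j
        rwa [hjab, hju] at this
      · have h : j⁻¹ * k ∈ stabilizer G u :=
          hau (by rw [mem_stabilizer_iff, mul_smul, hk, ← hjab, inv_smul_smul])
        simpa using mul_mem (show j ∈ stabilizer G u from hju) h
    have hle : stabilizer G (orientedPair s (Glue.mk G a b u) (Glue.mk G a b a)) =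
        stabilizer G (Glue.mk G a b a) := by
      rw [hmk, hs']
      exact inf_eq_right.2 (hHu.trans huu)
    have n1 : se' = stabInv G (Glue.mk G a b a) := stabInv_congr hle
    refine ⟨_, X.glue_notRoot hab hE' hE haR hbR hW (by rw [n1]; gcongr) ?_⟩
    have fa : Finite (stabilizer G a) := ea ▸ f1
    obtain ⟨r, hr, hp⟩ := exists_reflTransGen_mk_of_glueGroup_le X.dominates hHu
      (Or.inl fa) (Or.inl (finite_stabilizer_of_mem_orbit horb fa))
    refine ⟨r, hr, .head (stabArrow_of_orientedPair (s := s) ⟨_, h1, map_orientedPair ..⟩ ?_) hp⟩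
    rw [hmk]
    exact hHu.trans huu
  · have sa' : 2 * stabInv G a ≤ s1 := sa
    refine root 0 (by simpa using mass_mono Set.sdiff_subset) ?_
    rw [← NNReal.coe_le_coe] at sa' t1 ⊢
    push_cast at sa' t1 ⊢
    linarith

/-- The case of `IsResolution.exists_fold` where the end points `a` and `b` of the two edges lie in
the same orbit; no assumption is made on the edges themselves. -/
theorem IsResolution.exists_fold_of_mem_orbit (X : IsResolution G D n φ E R)
    (hD : ∀ d ∈ D, Finite (stabilizer G d)) {s : Bool} {u a b : W}
    (h1 : orientedPair s u a ∈ E) (h2 : orientedPair s u b ∈ E) (hab : φ a = φ b)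
    (horb : b ∈ orbit G a) {e : ℝ≥0∞}
    (hE' : mass G (glueEdges G a b E) ≤
      e + stabInv G (orientedPair s (Glue.mk G a b u) (Glue.mk G a b a)))
    (hE : e + (stabInv G (orientedPair s u a) + stabInv G (orientedPair s u b) : ℝ≥0) ≤ mass G E) :
    ∃ R', IsResolution G D n (Glue.lift X.map_smul hab) (glueEdges G a b E) R' := by
  have f1 := X.finite_stabilizer_edge hD h1
  have f2 := X.finite_stabilizer_edge hD h2
  have hs' := stabilizer_orientedPair (G := G) s (Glue.mk G a b u) (Glue.mk G a b a)
  have hs1 := stabilizer_orientedPair (G := G) s u a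
  have hs2 := stabilizer_orientedPair (G := G) s u b
  rw [Glue.stabilizer_mk_left] at hs'
  have n1 := stabInv_le_of_le (show stabilizer G (orientedPair s u a) ≤
      stabilizer G (orientedPair s (Glue.mk G a b u) (Glue.mk G a b a)) by
    rw [hs', hs1]
    exact inf_le_inf (stabilizer_le_of_equivariant Glue.mk_smul u)
      (stabilizer_left_le_glueGroup a b))
  have n2 := stabInv_le_of_le (show stabilizer G (orientedPair s u b) ≤ stabilizer G b from
    hs2 ▸ inf_le_right)
  have n3 : stabInv G b = stabInv G a := by
    obtain ⟨g, rfl⟩ := horb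
    exact stabInv_smul g a
  have := X.glue_root hab (c := 0) (ρ := 0) hE' hE (by simpa using mass_mono Set.sdiff_subset)
    (mass_univ_le_diff_add_of_mem_orbit horb) (by
      rw [← n3, add_zero, add_zero]
      exact add_le_add n1 n2)
  rw [add_zero] at this
  exact ⟨_, this⟩

/-- **Folding.** Two edges with a common end point `u` and the same image are folded by identifying
their other end points. The bound is preserved for a suitable set of roots, and the mass of the set
of edges drops. -/
theorem IsResolution.exists_fold (X : IsResolution G D n φ E R)
    (hD : ∀ d ∈ D, Finite (stabilizer G d)) {s : Bool} {u a b : W}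
    (h1 : orientedPair s u a ∈ E) (h2 : orientedPair s u b ∈ E) (hne : a ≠ b) (hab : φ a = φ b) :
    (∃ R', IsResolution G D n (Glue.lift X.map_smul hab) (glueEdges G a b E) R') ∧
      mass G (glueEdges G a b E) < mass G E := by
  have f1 := X.finite_stabilizer_edge hD h1
  have f2 := X.finite_stabilizer_edge hD h2
  have p1 := stabInv_pos f1
  have p2 := stabInv_pos f2
  have fE := mass_ne_top X.finite_edges
  set e₁ := orientedPair s u a with he₁
  set e₂ := orientedPair s u b with he₂
  set e' := orientedPair s (Glue.mk G a b u) (Glue.mk G a b a) with he'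
  have hm1 : Prod.map (Glue.mk G a b) (Glue.mk G a b) e₁ = e' := map_orientedPair ..
  have hm2 : Prod.map (Glue.mk G a b) (Glue.mk G a b) e₂ = e' := by
    rw [he₂, map_orientedPair, ← Glue.mk_left_eq_mk_right]
  have hst : IsStable G (orbit G e₁ ∪ orbit G e₂) := (isStable_orbit _).union (isStable_orbit _)
  set e := mass G (E \ (orbit G e₁ ∪ orbit G e₂)) with hedef
  have hE' : mass G (glueEdges G a b E) ≤ e + stabInv G e' := by
    have hsub : glueEdges G a b E ⊆ Prod.map (Glue.mk G a b) (Glue.mk G a b) ''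
        (E \ (orbit G e₁ ∪ orbit G e₂)) ∪ orbit G e' := by
      rintro _ ⟨x, hx, rfl⟩
      by_cases h : x ∈ orbit G e₁ ∪ orbit G e₂
      · right
        rcases h with ⟨g, rfl⟩ | ⟨g, rfl⟩
        · exact ⟨g, by
            change _ = Prod.map _ _ (g • e₁)
            rw [prodMap_smul Glue.mk_smul, hm1]⟩
        · exact ⟨g, by
            change _ = Prod.map _ _ (g • e₂)
            rw [prodMap_smul Glue.mk_smul, hm2]⟩
      · exact Or.inl ⟨x, ⟨hx, h⟩, rfl⟩
    refine (mass_mono hsub).trans ((mass_union_le _ _).trans ?_)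
    rw [mass_orbit]
    gcongr
    exact mass_image_le (prodMap_smul Glue.mk_smul) fun y hy =>
      X.finite_stabilizer_edge hD hy.1
  have fe : e ≠ ∞ := ne_top_of_le_ne_top fE (mass_mono Set.sdiff_subset)
  have n1 : stabInv G e' ≤ stabInv G e₁ := by
    have h := stabilizer_le_of_equivariant
      (prodMap_smul (f := Glue.mk G a b) Glue.mk_smul) e₁
    rw [hm1] at h
    exact stabInv_le_of_le h
  by_cases hj : e₂ ∈ orbit G e₁
  · obtain ⟨j, hj⟩ := hj
    have hj' : orientedPair s (j • u) (j • a) = orientedPair s u b := by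
      rw [← smul_orientedPair]
      exact hj
    obtain ⟨hju, hjab⟩ := orientedPair_inj.1 hj'
    have hE : e + stabInv G e₁ ≤ mass G E :=
      mass_diff_add_le X.stable_edges hst h1 (Or.inl (mem_orbit_self _))
    obtain ⟨hex, t⟩ := X.exists_fold_of_smul_eq hD h1 hne hab hju hjab hE' hE
    refine ⟨hex, lt_of_le_of_lt hE' (lt_of_lt_of_le ?_ hE)⟩
    refine ENNReal.add_lt_add_left fe (ENNReal.coe_lt_coe.2 ?_)
    rw [← NNReal.coe_lt_coe] at p1 ⊢
    rw [← NNReal.coe_le_coe] at t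
    push_cast at t p1 ⊢
    linarith
  · have hE : e + (stabInv G e₁ + stabInv G e₂ : ℝ≥0) ≤ mass G E := by
      rw [hedef, ← Set.sdiff_sdiff, ENNReal.coe_add, add_comm (stabInv G e₁ : ℝ≥0∞), ← add_assoc]
      refine le_trans ?_ (mass_diff_add_le X.stable_edges (isStable_orbit e₁) h1 (mem_orbit_self _))
      gcongr
      exact mass_diff_add_le (X.stable_edges.diff (isStable_orbit e₁)) (isStable_orbit e₂)
        ⟨h2, hj⟩ (mem_orbit_self _)
    refine ⟨?_, lt_of_le_of_lt hE' (lt_of_lt_of_le ?_ hE)⟩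
    · by_cases horb : b ∈ orbit G a
      · exact X.exists_fold_of_mem_orbit hD h1 h2 hab horb hE' hE
      · exact X.exists_fold_of_notMem_orbit hD h1 h2 hab horb hE' hE
    · refine ENNReal.add_lt_add_left fe (ENNReal.coe_lt_coe.2 ?_)
      exact n1.trans_lt (lt_add_of_pos_right _ p2)

/-- Connectedness of the graph with vertex set `W` and set of oriented edges `E`. -/
def IsConnectedBy (E : Set (W × W)) : Prop :=
  ∀ x y : W, Relation.EqvGen (fun x y => (x, y) ∈ E) x y

theorem IsConnectedBy.glueEdges {a b : W} (h : IsConnectedBy E) :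
    IsConnectedBy (glueEdges G a b E) := by
  intro x y
  obtain ⟨x, rfl⟩ := Glue.mk_surjective x
  obtain ⟨y, rfl⟩ := Glue.mk_surjective y
  have := h x y
  induction this with
  | rel x y h => exact .rel _ _ ⟨_, h, rfl⟩
  | refl x => exact .refl _
  | symm x y _ ih => exact .symm _ _ ih
  | trans x y z _ _ ih1 ih2 => exact .trans _ _ _ ih1 ih2

/-- No two edges with a common end point have the same image. -/
def IsFolded {W V : Type*} (φ : W → V) (E : Set (W × W)) : Prop :=
  ∀ (s : Bool) (u a b : W), orientedPair s u a ∈ E → orientedPair s u b ∈ E → φ a = φ b → a = b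

/-- After finitely many foldings a connected resolution becomes locally injective. The process
stops because the mass of the set of edges, multiplied by a common multiple `M` of the orders of the
groups that can occur, is a natural number that drops in each step. -/
theorem IsResolution.exists_isFolded.{w} {M : ℕ} (hM : M ≠ 0)
    (hD : ∀ d ∈ D, Nat.card (stabilizer G d) ∣ M) {W : Type w} [MulAction G W] {φ : W → V}
    {E : Set (W × W)} {R : Set W} (X : IsResolution G D n φ E R) (hc : IsConnectedBy E) :
    ∃ (W' : Type w) (_ : MulAction G W') (φ' : W' → V) (E' : Set (W' × W')) (R' : Set W'),
      IsResolution G D n φ' E' R' ∧ IsConnectedBy E' ∧ IsFolded φ' E' ∧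
        Set.range φ ⊆ Set.range φ' := by
  have hDf : ∀ d ∈ D, Finite (stabilizer G d) := fun d hd =>
    Nat.finite_of_card_ne_zero fun h => hM (Nat.eq_zero_of_zero_dvd (h ▸ hD d hd))
  have hdvd : ∀ {W : Type w} [MulAction G W] {φ : W → V} {E : Set (W × W)} {R : Set W},
      IsResolution G D n φ E R → ∀ e ∈ E, Nat.card (stabilizer G e) ∣ M :=
    fun X e he => (Subgroup.card_dvd_of_le
      (stabilizer_le_of_equivariant (prodMap_smul X.map_smul) e)).trans (hD _ (X.map_mem e he))
  obtain ⟨k, hk⟩ := exists_nat_eq_mul_mass X.finite_edges hM (hdvd X)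
  induction k using Nat.strong_induction_on generalizing W with
  | _ k ih =>
    by_cases hli : IsFolded φ E
    · exact ⟨W, _, φ, E, R, X, hc, hli, le_rfl⟩
    · unfold IsFolded at hli
      push Not at hli
      obtain ⟨s, u, a, b, h1, h2, hab, hne⟩ := hli
      obtain ⟨⟨R', X'⟩, hlt⟩ := X.exists_fold hDf h1 h2 hne hab
      obtain ⟨k', hk'⟩ := exists_nat_eq_mul_mass X'.finite_edges hM (hdvd X')
      have hkk : k' < k := by
        have : (k' : ℝ≥0∞) < k := by
          rw [← hk, ← hk']
          exact ENNReal.mul_lt_mul_right (by exact_mod_cast hM) (by simp) hlt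
        exact_mod_cast this
      obtain ⟨W', _, φ', E', R'', X'', hc', hli', hr⟩ := ih k' hkk X' hc.glueEdges hk'
      refine ⟨W', _, φ', E', R'', X'', hc', hli', subset_trans ?_ hr⟩
      rintro _ ⟨x, rfl⟩
      exact ⟨Glue.mk G a b x, rfl⟩

end Folding

/-! ### Orientations of the tree and the initial resolution -/

theorem exists_card_stabilizer_dvd {G : Type*} [Group G] {Y : Type*} [MulAction G Y] {s : Set Y}
    (h : (orbitsOf G s).Finite) (hs : ∀ y ∈ s, Finite (stabilizer G y)) :
    ∃ M : ℕ, M ≠ 0 ∧ ∀ y ∈ s, Nat.card (stabilizer G y) ∣ M := by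
  let f : orbitRel.Quotient G Y → ℕ := Quotient.lift (fun y => Nat.card (stabilizer G y)) (by
    rintro a b ⟨g, rfl⟩
    exact card_stabilizer_smul g b)
  refine ⟨∏ x ∈ h.toFinset, f x, ?_, fun y hy => ?_⟩
  · refine Finset.prod_ne_zero_iff.2 fun x hx => ?_
    obtain ⟨y, hy, rfl⟩ := h.mem_toFinset.1 hx
    have := hs y hy
    exact (Nat.card_pos : 0 < Nat.card (stabilizer G y)).ne'
  · exact Finset.dvd_prod_of_mem f (h.mem_toFinset.2 ⟨y, hy, rfl⟩)

theorem eqvGen_smul {G : Type*} [Group G] {W : Type*} [MulAction G W] {E : Set (W × W)} (hE : IsStable G E)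
    {x y : W} (h : Relation.EqvGen (fun x y => (x, y) ∈ E) x y) (g : G) :
    Relation.EqvGen (fun x y => (x, y) ∈ E) (g • x) (g • y) := by
  induction h with
  | rel x y h => exact .rel _ _ (hE g _ h)
  | refl x => exact .refl _
  | symm x y _ ih => exact .symm _ _ ih
  | trans x y z _ _ ih1 ih2 => exact .trans _ _ _ ih1 ih2

section FreeGSet

variable {G : Type*} [Group G] {I : Type*}

theorem stabilizer_free (x : Σ _ : I, G) : stabilizer G x = ⊥ := by
  refine eq_bot_iff.2 fun g hg => ?_
  obtain ⟨k, y⟩ := x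
  rw [mem_stabilizer_iff, Sigma.smul_mk] at hg
  have : g • y = y := by simpa using hg
  rw [smul_eq_mul, mul_eq_right] at this
  exact this

theorem stabInv_free (x : Σ _ : I, G) : stabInv G x = 1 := by
  rw [stabInv, stabilizer_free]
  simp

theorem orbitsOf_free :
    orbitsOf G (Set.univ : Set (Σ _ : I, G)) =
      Set.range fun k : I => Quotient.mk (orbitRel G (Σ _ : I, G)) ⟨k, 1⟩ := by
  ext x
  induction x using Quotient.ind with
  | _ x =>
    obtain ⟨k, g⟩ := x
    refine ⟨fun _ => ⟨k, mk_eq_mk_iff.2 ⟨g⁻¹, ?_⟩⟩, fun _ => ⟨_, trivial, rfl⟩⟩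
    rw [Sigma.smul_mk, smul_eq_mul, inv_mul_cancel]

theorem card_le_mass_free [Fintype I] :
    (Fintype.card I : ℝ≥0∞) ≤ mass G (Set.univ : Set (Σ _ : I, G)) := by
  unfold mass
  rw [orbitsOf_free]
  have hinj : Function.Injective
      fun k : I => Quotient.mk (orbitRel G (Σ _ : I, G)) ⟨k, 1⟩ := by
    intro k k' h
    obtain ⟨g, hg⟩ := mk_eq_mk_iff.1 h
    exact (congrArg Sigma.fst hg).symm
  rw [tsum_range (orbitWeight G) hinj]
  simp [stabInv_free]

end FreeGSet

namespace GTree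

open scoped NNReal

variable {G : Type*} [Group G] {V : Type*} [MulAction G V] (S : GTree G V)

theorem stabilizer_edge {u v : V} (h : S.graph.Adj u v) :
    stabilizer G (S.edge h) = stabilizer G (u, v) := by
  ext g
  rw [mem_stabilizer_prod, mem_stabilizer_iff]
  have : g • S.edge h = S.edge h ↔ s(g • u, g • v) = s(u, v) := Subtype.ext_iff
  rw [this, Sym2.eq_iff]
  exact ⟨fun h' => h'.resolve_right (S.no_inversion g h), Or.inl⟩

theorem exists_adj_quotMk_eq (x : S.QuotEdge) :
    ∃ d : V × V, ∃ h : S.graph.Adj d.1 d.2, S.quotMk (S.edge h) = x := by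
  induction x using Quotient.ind with
  | _ e =>
    obtain ⟨e, he⟩ := e
    induction e using Sym2.ind with
    | _ u v => exact ⟨(u, v), he, rfl⟩

/-- An oriented edge of the tree over the edge `x` of the quotient graph. -/
noncomputable def liftEdge (x : S.QuotEdge) : V × V := (S.exists_adj_quotMk_eq x).choose

theorem adj_liftEdge (x : S.QuotEdge) : S.graph.Adj (S.liftEdge x).1 (S.liftEdge x).2 :=
  (S.exists_adj_quotMk_eq x).choose_spec.choose

theorem quotMk_liftEdge (x : S.QuotEdge) : S.quotMk (S.edge (S.adj_liftEdge x)) = x :=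
  (S.exists_adj_quotMk_eq x).choose_spec.choose_spec

/-- The oriented edges of the tree over a set `F` of edges of the quotient graph, with respect to a
`G`-stable orientation, which exists as `G` does not invert edges. -/
def orientedOver (F : Set S.QuotEdge) : Set (V × V) := {d | ∃ x ∈ F, d ∈ orbit G (S.liftEdge x)}

theorem stable_orientedOver (F : Set S.QuotEdge) : IsStable G (S.orientedOver F) := by
  rintro g d ⟨x, hx, hd⟩
  exact ⟨x, hx, isStable_orbit _ g d hd⟩

theorem quotMk_edge_eq_iff {u v u' v' : V} (h : S.graph.Adj u v) (h' : S.graph.Adj u' v') :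
    S.quotMk (S.edge h) = S.quotMk (S.edge h') ↔
      ∃ g : G, (g • u' = u ∧ g • v' = v) ∨ (g • u' = v ∧ g • v' = u) := by
  have h1 : S.quotMk (S.edge h) = S.quotMk (S.edge h') ↔
      ∃ g : G, g • S.edge h' = S.edge h := mk_eq_mk_iff
  rw [h1]
  refine exists_congr fun g => ?_
  have : g • S.edge h' = S.edge h ↔ s(g • u', g • v') = s(u, v) := Subtype.ext_iff
  rw [this, Sym2.eq_iff]

theorem adj_of_mem_orientedOver {F : Set S.QuotEdge} {u v : V} (h : (u, v) ∈ S.orientedOver F) :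
    S.graph.Adj u v := by
  obtain ⟨x, -, g, hg⟩ := h
  obtain ⟨h1, h2⟩ := Prod.ext_iff.1 hg
  have := S.adj_smul g (S.adj_liftEdge x)
  rw [← show g • (S.liftEdge x).1 = u from h1, ← show g • (S.liftEdge x).2 = v from h2]
  exact this

theorem mem_orientedOver_or {F : Set S.QuotEdge} {u v : V} (h : S.graph.Adj u v) :
    ((u, v) ∈ S.orientedOver F ∨ (v, u) ∈ S.orientedOver F) ↔ S.quotMk (S.edge h) ∈ F := by
  constructor
  · rintro (⟨x, hx, g, hg⟩ | ⟨x, hx, g, hg⟩)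
    · obtain ⟨h1, h2⟩ := Prod.ext_iff.1 hg
      rw [← S.quotMk_liftEdge x] at hx
      rwa [(S.quotMk_edge_eq_iff h (S.adj_liftEdge x)).2 ⟨g, Or.inl ⟨h1, h2⟩⟩]
    · obtain ⟨h1, h2⟩ := Prod.ext_iff.1 hg
      rw [← S.quotMk_liftEdge x] at hx
      rwa [(S.quotMk_edge_eq_iff h (S.adj_liftEdge x)).2 ⟨g, Or.inr ⟨h1, h2⟩⟩]
  · intro hF
    obtain ⟨g, ⟨h1, h2⟩ | ⟨h1, h2⟩⟩ :=
      (S.quotMk_edge_eq_iff h (S.adj_liftEdge _)).1 (S.quotMk_liftEdge (S.quotMk (S.edge h))).symm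
    · exact Or.inl ⟨_, hF, g, Prod.ext h1 h2⟩
    · exact Or.inr ⟨_, hF, g, Prod.ext h1 h2⟩

theorem not_mem_orientedOver_swap {F F' : Set S.QuotEdge} {u v : V}
    (h : (u, v) ∈ S.orientedOver F) : (v, u) ∉ S.orientedOver F' := by
  intro h'
  have hadj := S.adj_of_mem_orientedOver h
  obtain ⟨x, hx, g, hg⟩ := h
  obtain ⟨x', hx', g', hg'⟩ := h'
  obtain ⟨h1, h2⟩ := Prod.ext_iff.1 hg
  obtain ⟨h1', h2'⟩ := Prod.ext_iff.1 hg'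
  change g • (S.liftEdge x).1 = u at h1
  change g • (S.liftEdge x).2 = v at h2
  change g' • (S.liftEdge x').1 = v at h1'
  change g' • (S.liftEdge x').2 = u at h2'
  have hxx : x = x' := by
    rw [← S.quotMk_liftEdge x, ← S.quotMk_liftEdge x', S.quotMk_edge_eq_iff]
    refine ⟨g⁻¹ * g', Or.inr ⟨?_, ?_⟩⟩
    · rw [mul_smul, h1', ← h2, inv_smul_smul]
    · rw [mul_smul, h2', ← h1, inv_smul_smul]
  subst hxx
  refine S.no_inversion (g' * g⁻¹) hadj ⟨?_, ?_⟩
  · rw [mul_smul, ← h1, inv_smul_smul, h1']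
  · rw [mul_smul, ← h2, inv_smul_smul, h2']

theorem weight_quotMk {u v : V} (h : S.graph.Adj u v) :
    S.weight (S.quotMk (S.edge h)) = (stabInv G (u, v) : ℝ≥0∞) := by
  change ((ENat.card (stabilizer G (S.edge h)) : ℕ∞) : ℝ≥0∞)⁻¹ = _
  rw [S.stabilizer_edge h, stabInv]
  by_cases hf : Finite (stabilizer G (u, v))
  · rw [ENat.card_eq_coe_natCard, ENNReal.coe_inv (by exact_mod_cast Nat.card_pos.ne')]
    simp
  · have : Infinite (stabilizer G (u, v)) := not_finite_iff_infinite.1 hf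
    rw [ENat.card_eq_top_of_infinite, Nat.card_eq_zero_of_infinite]
    simp

theorem mk_liftEdge_injective :
    Function.Injective fun x => Quotient.mk (orbitRel G (V × V)) (S.liftEdge x) := by
  intro x y h
  obtain ⟨g, hg⟩ := mk_eq_mk_iff.1 h
  obtain ⟨h1, h2⟩ := Prod.ext_iff.1 hg
  rw [← S.quotMk_liftEdge x, ← S.quotMk_liftEdge y, S.quotMk_edge_eq_iff]
  exact ⟨g, Or.inl ⟨h1, h2⟩⟩

theorem orbitsOf_orientedOver (F : Set S.QuotEdge) :
    orbitsOf G (S.orientedOver F) =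
      (fun x => Quotient.mk (orbitRel G (V × V)) (S.liftEdge x)) '' F := by
  ext y
  constructor
  · rintro ⟨_, ⟨x, hx, g, rfl⟩, rfl⟩
    exact ⟨x, hx, mk_eq_mk_iff.2 ⟨g⁻¹, inv_smul_smul g _⟩⟩
  · rintro ⟨x, hx, rfl⟩
    exact ⟨_, ⟨x, hx, mem_orbit_self _⟩, rfl⟩

theorem mass_orientedOver (F : Set S.QuotEdge) :
    mass G (S.orientedOver F) = ∑' x : F, S.weight x.1 := by
  unfold mass
  rw [orbitsOf_orientedOver, tsum_image (orbitWeight G) S.mk_liftEdge_injective.injOn]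
  refine tsum_congr fun x => ?_
  conv_rhs => rw [← S.quotMk_liftEdge x.1, weight_quotMk]
  rfl

theorem mass_orientedOver_univ : mass G (S.orientedOver Set.univ) = S.eta := by
  rw [mass_orientedOver, eta, tsum_univ S.weight]

theorem exists_parent (v₀ : V) : ∃ par : V → V, ∀ v, v ≠ v₀ →
    S.graph.Adj v (par v) ∧ S.graph.dist (par v) v₀ < S.graph.dist v v₀ := by
  have key : ∀ v : V, v ≠ v₀ → ∃ w, S.graph.Adj v w ∧ S.graph.dist w v₀ < S.graph.dist v v₀ := by
    intro v hv
    obtain ⟨p, hp⟩ := S.isTree.1.exists_walk_length_eq_dist v v₀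
    cases p with
    | nil => exact absurd rfl hv
    | cons h q =>
      refine ⟨_, h, ?_⟩
      have := SimpleGraph.dist_le q
      rw [SimpleGraph.Walk.length_cons] at hp
      omega
  have : Nonempty V := ⟨v₀⟩
  choose! par hpar using key
  exact ⟨par, hpar⟩

theorem exists_finset_parent_closed {v₀ : V} {par : V → V}
    (hpar : ∀ v, v ≠ v₀ → S.graph.Adj v (par v) ∧ S.graph.dist (par v) v₀ < S.graph.dist v v₀)
    (K₀ : Finset V) :
    ∃ K : Finset V, v₀ ∈ K ∧ K₀ ⊆ K ∧ ∀ k ∈ K, k ≠ v₀ → par k ∈ K := by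
  classical
  have key : ∀ v : V, ∃ K : Finset V, v₀ ∈ K ∧ v ∈ K ∧ ∀ k ∈ K, k ≠ v₀ → par k ∈ K := by
    intro v
    induction hn : S.graph.dist v v₀ using Nat.strong_induction_on generalizing v with
    | _ n ih =>
      by_cases hv : v = v₀
      · refine ⟨{v₀}, Finset.mem_singleton_self _, by simp [hv], fun k hk hk' => ?_⟩
        exact absurd (Finset.mem_singleton.1 hk) hk'
      · obtain ⟨K, h0, h1, h2⟩ := ih _ (hn ▸ (hpar v hv).2) (par v) rfl
        refine ⟨insert v K, Finset.mem_insert_of_mem h0, Finset.mem_insert_self _ _,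
          fun k hk hk' => Finset.mem_insert_of_mem ?_⟩
        rcases Finset.mem_insert.1 hk with rfl | hk
        · exact h1
        · exact h2 k hk hk'
  choose K h0 h1 h2 using key
  refine ⟨(insert v₀ K₀).biUnion K, ?_, ?_, ?_⟩
  · exact Finset.mem_biUnion.2 ⟨v₀, Finset.mem_insert_self _ _, h0 v₀⟩
  · exact fun k hk => Finset.mem_biUnion.2 ⟨k, Finset.mem_insert_of_mem hk, h1 k⟩
  · intro k hk hk'
    obtain ⟨v, hv, hkv⟩ := Finset.mem_biUnion.1 hk
    exact Finset.mem_biUnion.2 ⟨v, hv, h2 v k hkv hk'⟩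

/-- The free `G`-set on a finite set of vertices of the tree, with its map to the tree. -/
def freeMap (K : Finset V) : (Σ _ : K, G) → V := fun x => x.2 • (x.1 : V)

theorem freeMap_smul (K : Finset V) (g : G) (x : Σ _ : K, G) :
    freeMap K (g • x) = g • freeMap K x := mul_smul g x.2 (x.1 : V)

/-- A finite set `K` of vertices that is closed under passing to the parent gives a resolution with
bound `0`: its vertex set is free on `K`, its edges join each vertex to its parent, and the copies
of `v₀` are the roots. -/
theorem isResolution_free {v₀ : V} {par : V → V}
    (hpar : ∀ v, v ≠ v₀ → S.graph.Adj v (par v) ∧ S.graph.dist (par v) v₀ < S.graph.dist v v₀)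
    {K : Finset V} (h0 : v₀ ∈ K) (hK : ∀ k ∈ K, k ≠ v₀ → par k ∈ K) :
    ∃ E : Set ((Σ _ : K, G) × (Σ _ : K, G)),
      IsResolution G (S.orientedOver Set.univ) 0 (freeMap K) E
        (orbit G (⟨⟨v₀, h0⟩, 1⟩ : Σ _ : K, G)) ∧
      ∀ x : Σ _ : K, G, Relation.EqvGen (fun x y => (x, y) ∈ E) x ⟨⟨v₀, h0⟩, x.2⟩ := by
  classical
  have hd : ∀ k : K, ∃ d : (Σ _ : K, G) × (Σ _ : K, G), k.1 ≠ v₀ →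
      ∃ hk : par k ∈ K, (d = (⟨k, 1⟩, ⟨⟨par k, hk⟩, 1⟩) ∨ d = (⟨⟨par k, hk⟩, 1⟩, ⟨k, 1⟩)) ∧
        Prod.map (freeMap K) (freeMap K) d ∈ S.orientedOver Set.univ := by
    intro k
    by_cases hk : k.1 = v₀
    · exact ⟨(⟨k, 1⟩, ⟨k, 1⟩), fun h => absurd hk h⟩
    · have hk' := hK k k.2 hk
      rcases (S.mem_orientedOver_or (F := Set.univ) (hpar k hk).1).2 trivial with h | h
      · refine ⟨_, fun _ => ⟨hk', Or.inl rfl, ?_⟩⟩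
        simpa [freeMap] using h
      · refine ⟨_, fun _ => ⟨hk', Or.inr rfl, ?_⟩⟩
        simpa [freeMap] using h
  choose d hd using hd
  set b : Σ _ : K, G := ⟨⟨v₀, h0⟩, 1⟩ with hb
  let J : Finset K := Finset.univ.erase ⟨v₀, h0⟩
  have hJ : ∀ k ∈ J, k.1 ≠ v₀ := fun k hk h => (Finset.mem_erase.1 hk).1 (Subtype.ext h)
  let E : Set ((Σ _ : K, G) × (Σ _ : K, G)) := ⋃ k ∈ J, orbit G (d k)
  have hEmem : ∀ {k : K} (g : G), k ∈ J → g • d k ∈ E := fun {k} g hk =>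
    Set.mem_biUnion (show k ∈ (J : Set K) from hk) (mem_orbit _ g)
  have hEst : IsStable G E := by
    intro g e he
    obtain ⟨k, hk, g', rfl⟩ := Set.mem_iUnion₂.1 he
    change g • g' • d k ∈ E
    rw [← mul_smul]
    exact hEmem _ hk
  have hedge : ∀ (k : K) (hk : k.1 ≠ v₀) (g : G),
      (((⟨k, g⟩ : Σ _ : K, G), (⟨⟨par k, hK k k.2 hk⟩, g⟩ : Σ _ : K, G)) ∈ E ∨
        ((⟨⟨par k, hK k k.2 hk⟩, g⟩ : Σ _ : K, G), (⟨k, g⟩ : Σ _ : K, G)) ∈ E) := by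
    intro k hk g
    have hkJ : k ∈ J := Finset.mem_erase.2 ⟨fun h => hk (congrArg Subtype.val h),
      Finset.mem_univ _⟩
    have h1 := hEmem g hkJ
    obtain ⟨hk', h | h, -⟩ := hd k hk
    · left
      rw [h, Prod.smul_mk, Sigma.smul_mk, Sigma.smul_mk, smul_eq_mul, mul_one] at h1
      exact h1
    · right
      rw [h, Prod.smul_mk, Sigma.smul_mk, Sigma.smul_mk, smul_eq_mul, mul_one] at h1
      exact h1
  refine ⟨E, ?_, ?_⟩
  · refine ⟨freeMap_smul K, hEst, isStable_orbit _, ?_, ?_, ?_, ?_, ?_⟩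
    · intro e he
      obtain ⟨k, hk, g, rfl⟩ := Set.mem_iUnion₂.1 he
      change Prod.map _ _ (g • d k) ∈ _
      rw [prodMap_smul (freeMap_smul K)]
      exact S.stable_orientedOver _ g _ (hd k (hJ k hk)).2.2
    · rw [orbitsOf_free]
      exact Set.finite_range _
    · have : orbitsOf G E = ⋃ k ∈ J, orbitsOf G (orbit G (d k)) := by
        unfold orbitsOf E
        simp only [Set.image_iUnion]
      rw [this]
      refine Set.Finite.biUnion J.finite_toSet fun k _ => ?_
      rw [orbitsOf_orbit]
      exact Set.finite_singleton _
    · rintro ⟨k, g⟩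
      induction hn : S.graph.dist k.1 v₀ using Nat.strong_induction_on generalizing k with
      | _ n ih =>
        by_cases hk : k.1 = v₀
        · refine ⟨_, ?_, .refl⟩
          have : k = ⟨v₀, h0⟩ := Subtype.ext hk
          rw [this]
          exact ⟨g, by simp [hb]⟩
        · obtain ⟨r, hr, hp⟩ := ih _ (hn ▸ (hpar k hk).2) ⟨par k, hK k k.2 hk⟩ rfl
          refine ⟨r, hr, .head ⟨hedge k hk g, ?_⟩ hp⟩
          rw [stabilizer_free]
          exact bot_le
    · rw [mass_orbit, stabInv_free]
      have h1 : mass G E ≤ J.card := mass_iUnion_orbit_le J d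
      have h2 : J.card + 1 = K.card := by
        rw [Finset.card_erase_add_one (Finset.mem_univ _), Finset.card_univ, Fintype.card_coe]
      calc mass G E + ((1 : ℝ≥0) : ℝ≥0∞) ≤ (J.card : ℝ≥0∞) + 1 := by
            rw [ENNReal.coe_one]
            gcongr
        _ = (K.card : ℝ≥0∞) := by exact_mod_cast h2
        _ ≤ _ := by
          rw [ENNReal.coe_zero, zero_add]
          simpa using card_le_mass_free (G := G) (I := K)
  · rintro ⟨k, g⟩
    induction hn : S.graph.dist k.1 v₀ using Nat.strong_induction_on generalizing k with
    | _ n ih =>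
      by_cases hk : k.1 = v₀
      · have : k = ⟨v₀, h0⟩ := Subtype.ext hk
        rw [this]
        exact .refl _
      · refine .trans _ _ _ ?_ (ih _ (hn ▸ (hpar k hk).2) ⟨par k, hK k k.2 hk⟩ rfl)
        rcases hedge k hk g with h | h
        · exact .rel _ _ h
        · exact .symm _ _ (.rel _ _ h)

/-- Starting from a resolution and a root `b`, identify for each `s` in a finite set `T` a point
over `s • φ b` with `s • b`. Each identification raises the bound by at most `1`. -/
theorem exists_isResolution_glue.{w} {V : Type*} [MulAction G V] {D : Set (V × V)} {n : ℝ≥0}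
    {W : Type w} [MulAction G W] {φ : W → V} {E : Set (W × W)} {R : Set W}
    (X : IsResolution G D n φ E R) (hD : ∀ d ∈ D, Finite (stabilizer G d)) {b : W} (hb : b ∈ R)
    (c : G → W) (T : Finset G) (hc : ∀ s ∈ T, φ (c s) = s • φ b) :
    ∃ (W' : Type w) (_ : MulAction G W') (φ' : W' → V) (E' : Set (W' × W')) (R' : Set W')
      (ι : W → W'), IsResolution G D (n + T.card) φ' E' R' ∧ (∀ (g : G) x, ι (g • x) = g • ι x) ∧
        Function.Surjective ι ∧ (∀ x, φ' (ι x) = φ x) ∧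
        (∀ x y, (x, y) ∈ E → (ι x, ι y) ∈ E') ∧ ι b ∈ R' ∧ ∀ s ∈ T, ι (c s) = s • ι b := by
  classical
  induction T using Finset.induction_on with
  | empty =>
    refine ⟨W, _, φ, E, R, id, by simpa using X, fun _ _ => rfl, Function.surjective_id,
      fun _ => rfl, fun _ _ h => h, hb, by simp⟩
  | insert s T hs ih =>
    obtain ⟨W', _, φ', E', R', ι, X', hι, hsurj, hφ, hE, hbR, hT⟩ :=
      ih fun t ht => hc t (Finset.mem_insert_of_mem ht)
    have hab : φ' (ι (c s)) = φ' (s • ι b) := by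
      rw [hφ, ← hι, hφ, hc s (Finset.mem_insert_self _ _), X.map_smul]
    have hsb : s • ι b ∈ R' := X'.stable_roots s _ hbR
    have Y := X'.glue_root hab (e := mass G E') (c := 1) (α := 0) (ε := 0)
      (ω := stabInv G (ι (c s)) + stabInv G (s • ι b)) (ρ := stabInv G (s • ι b))
      (by
        rw [ENNReal.coe_zero, add_zero]
        exact mass_image_le (prodMap_smul Glue.mk_smul) fun y hy =>
          X'.finite_stabilizer_edge hD hy)
      (by rw [ENNReal.coe_zero, add_zero])
      (mass_diff_add_le X'.stable_roots stable_orbit_union_orbit hsb (Or.inr (mem_orbit_self _)))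
      mass_univ_le_diff_add
      (by
        rw [zero_add, zero_add, add_comm]
        gcongr
        exact stabInv_le_one _)
    refine ⟨Glue G (ι (c s)) (s • ι b), inferInstance, Glue.lift X'.map_smul hab, glueEdges G (ι (c s)) (s • ι b) E',
      Glue.mk G (ι (c s)) (s • ι b) '' R' ∪ orbit G (Glue.mk G (ι (c s)) (s • ι b) (ι (c s))),
      fun x => Glue.mk G (ι (c s)) (s • ι b) (ι x), ?_, ?_, ?_, ?_, ?_,
      ?_, ?_⟩
    · rw [Finset.card_insert_of_notMem hs, Nat.cast_add, Nat.cast_one, ← add_assoc]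
      exact Y
    · intro g x
      change Glue.mk G _ _ (ι (g • x)) = _
      rw [hι, Glue.mk_smul]
    · exact Glue.mk_surjective.comp hsurj
    · exact hφ
    · exact fun x y h => ⟨_, hE x y h, rfl⟩
    · exact Or.inl ⟨_, hbR, rfl⟩
    · intro t ht
      rcases Finset.mem_insert.1 ht with rfl | ht
      · exact Glue.mk_left_eq_mk_right G _ _
      · change Glue.mk G _ _ (ι (c t)) = _
        rw [hT t ht, Glue.mk_smul]

/-- A connected resolution of the tree whose bound is the number of generators of `G`. -/
theorem exists_connected_resolution.{u, v} {G : Type u} [Group G] {V : Type v} [MulAction G V]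
    (S : GTree G V) (hfin : S.FiniteEdgeStabilizers) {T : Finset G}
    (hT : Subgroup.closure (T : Set G) = ⊤) (K₀ : Finset V) :
    ∃ (W : Type (max u v)) (_ : MulAction G W) (φ : W → V) (E : Set (W × W)) (R : Set W),
      IsResolution G (S.orientedOver Set.univ) T.card φ E R ∧ IsConnectedBy E ∧
        ∀ k ∈ K₀, k ∈ Set.range φ := by
  classical
  obtain ⟨v₀⟩ := S.isTree.1.nonempty
  obtain ⟨par, hpar⟩ := S.exists_parent v₀
  obtain ⟨K, h0, hK₀, hK⟩ := S.exists_finset_parent_closed hpar (K₀ ∪ T.image fun s => s • v₀)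
  obtain ⟨E₀, X₀, hconn⟩ := S.isResolution_free hpar h0 hK
  have hD : ∀ d ∈ S.orientedOver Set.univ, Finite (stabilizer G d) := by
    rintro ⟨u, v⟩ hd
    rw [← S.stabilizer_edge (S.adj_of_mem_orientedOver hd)]
    exact hfin _
  have hc : ∀ s : G, ∃ x : Σ _ : K, G, s ∈ T → x.2 = 1 ∧ freeMap K x = s • v₀ := by
    intro s
    by_cases hs : s ∈ T
    · exact ⟨⟨⟨s • v₀, hK₀ (Finset.mem_union_right _ (Finset.mem_image_of_mem _ hs))⟩, 1⟩,
        fun _ => ⟨rfl, one_smul _ _⟩⟩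
    · exact ⟨⟨⟨v₀, h0⟩, 1⟩, fun h => absurd h hs⟩
  choose c hc using hc
  obtain ⟨W, _, φ, E, R, ι, X, hι, hsurj, hφ, hE, hbR, hglue⟩ :=
    exists_isResolution_glue X₀ hD (mem_orbit_self _) c T (fun s hs => by
      rw [(hc s hs).2]
      simp [freeMap])
  have hmap : ∀ {x y}, Relation.EqvGen (fun x y => (x, y) ∈ E₀) x y →
      Relation.EqvGen (fun x y => (x, y) ∈ E) (ι x) (ι y) := by
    intro x y h
    induction h with
    | rel x y h => exact .rel _ _ (hE _ _ h)
    | refl x => exact .refl _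
    | symm x y _ ih => exact .symm _ _ ih
    | trans x y z _ _ ih1 ih2 => exact .trans _ _ _ ih1 ih2
  set b : Σ _ : K, G := ⟨⟨v₀, h0⟩, 1⟩ with hb
  have hgen : ∀ g : G, Relation.EqvGen (fun x y => (x, y) ∈ E) (g • ι b) (ι b) := by
    intro g
    have hg : g ∈ Subgroup.closure (T : Set G) := hT ▸ Subgroup.mem_top g
    induction hg using Subgroup.closure_induction with
    | mem s hs =>
      rw [← hglue s hs]
      have h := hmap (hconn (c s))
      rw [(hc s hs).1] at h
      exact h
    | one =>
      rw [one_smul]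
      exact .refl _
    | mul x y _ _ hx hy =>
      rw [mul_smul]
      exact .trans _ _ _ (eqvGen_smul X.stable_edges hy x) hx
    | inv x _ hx =>
      have := eqvGen_smul X.stable_edges hx x⁻¹
      rw [inv_smul_smul] at this
      exact .symm _ _ this
  have hall : ∀ x : W, Relation.EqvGen (fun x y => (x, y) ∈ E) x (ι b) := by
    intro x
    obtain ⟨x, rfl⟩ := hsurj x
    have h1 := hmap (hconn x)
    have h2 : (⟨⟨v₀, h0⟩, x.2⟩ : Σ _ : K, G) = x.2 • b := by simp [hb]
    rw [h2, hι] at h1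
    exact .trans _ _ _ h1 (hgen _)
  refine ⟨W, _, φ, E, R, by simpa using X, fun x y => .trans _ _ _ (hall x) (.symm _ _ (hall y)),
    fun k hk => ⟨ι ⟨⟨k, hK₀ (Finset.mem_union_left _ hk)⟩, 1⟩, ?_⟩⟩
  rw [hφ]
  exact one_smul _ _

end GTree

/-! ### Folded graphs over the tree; reduced trees -/

namespace GTree

open scoped NNReal

variable {G : Type*} [Group G] {V : Type*} [MulAction G V] (S : GTree G V)

/-- A folded connected graph over a tree embeds: the image of a path has no backtracking, so it is
a path in the tree, and it is not closed unless it is trivial. -/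
theorem injective_of_isFolded {W : Type*} {φ : W → V} {E : Set (W × W)}
    (hE : ∀ e ∈ E, Prod.map φ φ e ∈ S.orientedOver Set.univ) (hc : IsConnectedBy E)
    (hf : IsFolded φ E) : Function.Injective φ := by
  let X : SimpleGraph W := SimpleGraph.fromRel fun x y => (x, y) ∈ E
  have hadj : ∀ {x y}, X.Adj x y → (x, y) ∈ E ∨ (y, x) ∈ E := fun h => h.2
  have hmap : ∀ {x y}, X.Adj x y → S.graph.Adj (φ x) (φ y) := by
    intro x y h
    rcases hadj h with h | h
    · exact S.adj_of_mem_orientedOver (hE _ h)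
    · exact (S.adj_of_mem_orientedOver (hE _ h)).symm
  let F : X →g S.graph := ⟨φ, hmap⟩
  have hreach : ∀ x y, X.Reachable x y := by
    intro x y
    have := hc x y
    induction this with
    | rel x y h =>
      by_cases hxy : x = y
      · exact hxy ▸ SimpleGraph.Reachable.refl _
      · exact SimpleGraph.Adj.reachable ⟨hxy, Or.inl h⟩
    | refl x => exact SimpleGraph.Reachable.refl _
    | symm x y _ ih => exact ih.symm
    | trans x y z _ _ ih1 ih2 => exact ih1.trans ih2
  have hloc : ∀ {u a b}, X.Adj u a → X.Adj u b → φ a = φ b → a = b := by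
    intro u a b ha hb hab
    rcases hadj ha with ha | ha <;> rcases hadj hb with hb | hb
    · exact hf true u a b ha hb hab
    · have h1 : (φ u, φ b) ∈ S.orientedOver Set.univ := hab ▸ hE _ ha
      exact absurd (hE _ hb) (S.not_mem_orientedOver_swap h1)
    · have h1 : (φ u, φ a) ∈ S.orientedOver Set.univ := hab ▸ hE _ hb
      exact absurd (hE _ ha) (S.not_mem_orientedOver_swap h1)
    · exact hf false u a b ha hb hab
  have hpath : ∀ {x y : W} (p : X.Walk x y), p.IsPath → (p.map F).IsPath := by
    intro x y p hp
    rw [S.isTree.2.isPath_iff_isChain]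
    induction p with
    | nil => simp
    | @cons u v w h q ih =>
      have ih := ih hp.of_cons
      cases q with
      | nil => simp
      | @cons _ v' _ h' q' =>
        rw [SimpleGraph.Walk.map_cons, SimpleGraph.Walk.edges_cons, SimpleGraph.Walk.map_cons,
          SimpleGraph.Walk.edges_cons, List.isChain_cons_cons]
        refine ⟨fun heq => ?_, ih⟩
        have hne : u ≠ v' := by
          rintro rfl
          rw [SimpleGraph.Walk.cons_isPath_iff] at hp
          exact hp.2 (by simp)
        have h1 : s(φ u, φ v) = s(φ v, φ v') := heq
        rcases Sym2.eq_iff.1 h1 with ⟨h2, _⟩ | ⟨h2, _⟩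
        · exact (hmap h).ne h2
        · exact hne (hloc h.symm h' h2)
  intro x y hxy
  obtain ⟨p, hp⟩ := (hreach x y).exists_isPath
  have h1 := hpath p hp
  by_contra hne
  have hlen : (p.map F).length ≠ 0 := by
    rw [SimpleGraph.Walk.length_map]
    exact fun h => hne (SimpleGraph.Walk.eq_of_length_eq_zero h)
  have h2 : ∀ {a b : V} (q : S.graph.Walk a b), q.IsPath → a = b → q.length = 0 := by
    rintro a b q hq rfl
    exact SimpleGraph.Walk.length_eq_zero_iff.2 (SimpleGraph.Walk.isPath_iff_nil.1 hq)
  exact hlen (h2 _ h1 hxy)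

/-- A `G`-stable subtree of `S`, with vertex set `T` and set of oriented edges `E`, that satisfies
the bound by `n` for a dominating set `R` of vertices. -/
structure IsBoundedSubtree (n : ℝ≥0) (T : Set V) (E : Set (V × V)) (R : Set V) : Prop where
  stable : IsStable G T
  stable_roots : IsStable G R
  roots_subset : R ⊆ T
  edges_subset : E ⊆ S.orientedOver Set.univ
  mem_of_edge : ∀ e ∈ E, e.1 ∈ T ∧ e.2 ∈ T
  connected : ∀ x ∈ T, ∀ y ∈ T, Relation.EqvGen (fun x y => (x, y) ∈ E) x y
  finite_vertices : (orbitsOf G T).Finite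
  finite_edges : (orbitsOf G E).Finite
  dominates : ∀ t ∈ T, ∃ r ∈ R, Relation.ReflTransGen (StabArrow G E) t r
  bound : mass G E + mass G R ≤ n + mass G T

/-- If `G` is generated by `T`, each finite set of vertices is contained in a `G`-stable subtree
with bound `T.card`. -/
theorem exists_isBoundedSubtree (hfin : S.FiniteEdgeStabilizers) {A : Finset G}
    (hA : Subgroup.closure (A : Set G) = ⊤) (K₀ : Finset V) :
    ∃ (T : Set V) (E : Set (V × V)) (R : Set V),
      S.IsBoundedSubtree A.card T E R ∧ ∀ k ∈ K₀, k ∈ T := by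
  obtain ⟨W₀, _, φ₀, E₀, R₀, X₀, hc₀, hK₀⟩ := S.exists_connected_resolution hfin hA K₀
  have hDst : ∀ d ∈ Prod.map φ₀ φ₀ '' E₀, Finite (stabilizer G d) := by
    rintro _ ⟨e, he, rfl⟩
    have h := X₀.map_mem e he
    rw [show Prod.map φ₀ φ₀ e = (φ₀ e.1, φ₀ e.2) from rfl] at h ⊢
    rw [← S.stabilizer_edge (S.adj_of_mem_orientedOver h)]
    exact hfin _
  have hDsub : Prod.map φ₀ φ₀ '' E₀ ⊆ S.orientedOver Set.univ := by
    rintro _ ⟨e, he, rfl⟩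
    exact X₀.map_mem e he
  -- Only finitely many edge orbits of the tree are met, so the orders have a common multiple.
  obtain ⟨M, hM, hMd⟩ := exists_card_stabilizer_dvd
    (finite_orbitsOf_image (prodMap_smul X₀.map_smul) X₀.finite_edges) hDst
  have X₁ : IsResolution G (Prod.map φ₀ φ₀ '' E₀) A.card φ₀ E₀ R₀ :=
    { X₀ with map_mem := fun e he => ⟨e, he, rfl⟩ }
  obtain ⟨W, _, φ, E, R, X, hc, hf, hr⟩ := X₁.exists_isFolded hM hMd hc₀
  have hinj := S.injective_of_isFolded (fun e he => hDsub (X.map_mem e he)) hc hf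
  have hinj2 : Function.Injective (Prod.map φ φ) := hinj.prodMap hinj
  have hst : ∀ x, stabilizer G (φ x) = stabilizer G x := fun x =>
    stabilizer_eq_of_injOn isStable_univ X.map_smul hinj.injOn (Set.mem_univ x)
  refine ⟨Set.range φ, Prod.map φ φ '' E, φ '' R, ?_, fun k hk => hr (hK₀ k hk)⟩
  constructor
  · rintro g _ ⟨x, rfl⟩
    exact ⟨g • x, X.map_smul g x⟩
  · exact X.stable_roots.image X.map_smul
  · exact Set.image_subset_range _ _
  · rintro _ ⟨e, he, rfl⟩
    exact hDsub (X.map_mem e he)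
  · rintro _ ⟨e, he, rfl⟩
    exact ⟨⟨e.1, rfl⟩, ⟨e.2, rfl⟩⟩
  · rintro _ ⟨x, rfl⟩ _ ⟨y, rfl⟩
    have := hc x y
    induction this with
    | rel x y h => exact .rel _ _ ⟨_, h, rfl⟩
    | refl x => exact .refl _
    | symm x y _ ih => exact .symm _ _ ih
    | trans x y z _ _ ih1 ih2 => exact .trans _ _ _ ih1 ih2
  · rw [← Set.image_univ]
    exact finite_orbitsOf_image X.map_smul X.finite_vertices
  · exact finite_orbitsOf_image (prodMap_smul X.map_smul) X.finite_edges
  · rintro _ ⟨x, rfl⟩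
    obtain ⟨r, hr, hp⟩ := X.dominates x
    refine ⟨φ r, ⟨r, hr, rfl⟩, hp.lift φ fun a b h => ⟨?_, ?_⟩⟩
    · exact h.1.imp (fun h => ⟨_, h, rfl⟩) (fun h => ⟨_, h, rfl⟩)
    · rw [hst, hst]
      exact h.2
  · rw [← Set.image_univ, mass_image_of_injOn X.stable_edges (prodMap_smul X.map_smul)
      hinj2.injOn, mass_image_of_injOn X.stable_roots X.map_smul hinj.injOn,
      mass_image_of_injOn isStable_univ X.map_smul hinj.injOn]
    exact X.bound

variable {S} {n : ℝ≥0} {T : Set V} {E : Set (V × V)} {R : Set V}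

/-- If the edge `uv` does not belong to the subtree, then the vertices of the subtree are joined
to each other after this edge is removed from the tree. -/
theorem IsBoundedSubtree.reachable_deleteEdges (h : S.IsBoundedSubtree n T E R) {u v : V}
    (h1 : (u, v) ∉ E) (h2 : (v, u) ∉ E) {x y : V} (hx : x ∈ T) (hy : y ∈ T) :
    (S.graph.deleteEdges {s(u, v)}).Reachable x y := by
  have := h.connected x hx y hy
  clear hx hy
  induction this with
  | rel x y hxy =>
    refine SimpleGraph.Adj.reachable ?_
    rw [SimpleGraph.deleteEdges_adj]
    refine ⟨S.adj_of_mem_orientedOver (h.edges_subset hxy), fun heq => ?_⟩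
    rcases Sym2.eq_iff.1 heq with ⟨rfl, rfl⟩ | ⟨rfl, rfl⟩
    · exact h1 hxy
    · exact h2 hxy
  | refl x => exact SimpleGraph.Reachable.refl _
  | symm x y _ ih => exact ih.symm
  | trans x y z _ _ ih1 ih2 => exact ih1.trans ih2

theorem not_reachable_deleteEdges {u v : V} (h : S.graph.Adj u v) :
    ¬ (S.graph.deleteEdges {s(u, v)}).Reachable u v :=
  SimpleGraph.isBridge_iff.1 (SimpleGraph.isAcyclic_iff_forall_adj_isBridge.1 S.isTree.2 h)

/-- A subtree contains the edges that join its vertices. -/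
theorem IsBoundedSubtree.mem_edges (h : S.IsBoundedSubtree n T E R) {u v : V} (hu : u ∈ T)
    (hv : v ∈ T) (huv : (u, v) ∈ S.orientedOver Set.univ) : (u, v) ∈ E := by
  by_contra h1
  refine not_reachable_deleteEdges (S.adj_of_mem_orientedOver huv)
    (h.reachable_deleteEdges h1 (fun h2 => ?_) hu hv)
  exact S.not_mem_orientedOver_swap huv (h.edges_subset h2)

theorem IsBoundedSubtree.edges_eq (h : S.IsBoundedSubtree n Set.univ E R) :
    E = S.orientedOver Set.univ :=
  Set.Subset.antisymm h.edges_subset fun _ he => h.mem_edges trivial trivial he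

theorem stabilizer_edge_eq_left {u v : V} (h : S.graph.Adj u v)
    (hle : stabilizer G u ≤ stabilizer G v) : stabilizer G (S.edge h) = stabilizer G u := by
  rw [S.stabilizer_edge, stabilizer_mk_eq]
  exact inf_eq_left.2 hle

theorem adj_of_stabArrow (hE : E ⊆ S.orientedOver Set.univ) {u v : V} (h : StabArrow G E u v) :
    S.graph.Adj u v :=
  h.1.elim (fun h => S.adj_of_mem_orientedOver (hE h))
    (fun h => (S.adj_of_mem_orientedOver (hE h)).symm)

/-- In a reduced tree, a nonempty stable subtree is everything: otherwise a vertex next to it could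
be compressed into it. -/
theorem IsBoundedSubtree.eq_univ (h : S.IsBoundedSubtree n T E R) (hred : S.IsReduced)
    (hne : T.Nonempty) : T = Set.univ := by
  obtain ⟨t₀, ht₀⟩ := hne
  refine Set.eq_univ_of_forall fun v => ?_
  obtain ⟨p⟩ := S.isTree.1.preconnected v t₀
  induction p with
  | nil => exact ht₀
  | @cons v t _ hadj _ ih =>
    have ht := ih ht₀
    by_contra hv
    have hle : stabilizer G v ≤ stabilizer G t := by
      intro g hg
      by_contra hgt
      have hgv : g • v = v := hg
      have hadj' : S.graph.Adj (g • t) v := by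
        have := S.adj_smul g hadj.symm
        rwa [hgv] at this
      have r1 := h.reachable_deleteEdges (u := v) (v := t) (fun h' => hv (h.mem_of_edge _ h').1)
        (fun h' => hv (h.mem_of_edge _ h').2) (h.stable g t ht) ht
      refine not_reachable_deleteEdges hadj (SimpleGraph.Reachable.trans ?_ r1)
      refine SimpleGraph.Adj.reachable ?_
      rw [SimpleGraph.deleteEdges_adj]
      refine ⟨hadj'.symm, fun heq => ?_⟩
      rcases Sym2.eq_iff.1 heq with ⟨-, h'⟩ | ⟨h', -⟩
      · exact hgt h'
      · exact hadj.ne h'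
    obtain ⟨g, hg⟩ := hred v t hadj (stabilizer_edge_eq_left hadj hle)
    exact hv ((h.stable.smul_mem_iff (g := g)).1 (by rwa [show g • v = t from hg]))

/-- In a reduced tree there are no vertices to compress, so every vertex is a root. -/
theorem IsBoundedSubtree.subset_roots (h : S.IsBoundedSubtree n T E R) (hred : S.IsReduced) :
    T ⊆ R := by
  intro t ht
  obtain ⟨r, hr, hp⟩ := h.dominates t ht
  have key : ∀ x, Relation.ReflTransGen (StabArrow G E) x r → x ∈ R := by
    intro x hx
    induction hx using Relation.ReflTransGen.head_induction_on with
    | refl => exact hr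
    | head hxy _ ih =>
      have hadj := adj_of_stabArrow h.edges_subset hxy
      obtain ⟨g, hg⟩ := hred _ _ hadj (stabilizer_edge_eq_left hadj hxy.2)
      exact (h.stable_roots.smul_mem_iff (g := g)).1 (by rwa [show g • _ = _ from hg])
  exact key t hp

theorem orbitsOf_orientedOver_finite_iff :
    (orbitsOf G (S.orientedOver Set.univ)).Finite ↔ Finite S.QuotEdge := by
  rw [orbitsOf_orientedOver, Set.finite_image_iff S.mk_liftEdge_injective.injOn,
    Set.finite_univ_iff]

theorem finite_and_eta_le_of_isReduced (hfin : S.FiniteEdgeStabilizers) {A : Finset G}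
    (hA : Subgroup.closure (A : Set G) = ⊤) (hred : S.IsReduced) :
    Finite S.QuotEdge ∧ S.eta ≤ A.card := by
  obtain ⟨v₀⟩ := S.isTree.1.nonempty
  obtain ⟨T, E, R, h, hv₀⟩ := S.exists_isBoundedSubtree hfin hA {v₀}
  obtain rfl := h.eq_univ hred ⟨v₀, hv₀ v₀ (Finset.mem_singleton_self _)⟩
  obtain rfl := h.edges_eq
  obtain rfl : R = Set.univ := Set.univ_subset_iff.1 (h.subset_roots hred)
  refine ⟨orbitsOf_orientedOver_finite_iff.1 h.finite_edges, ?_⟩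
  have hb := h.bound
  rw [mass_orientedOver_univ] at hb
  simpa using (ENNReal.add_le_add_iff_right (mass_ne_top h.finite_vertices)).1 hb

end GTree

/-! ### Compressing forests -/

namespace GTree

open scoped NNReal

variable {G : Type*} [Group G] {V : Type*} [MulAction G V] {S : GTree G V}

/-- A vertex without an outgoing arrow. -/
def IsSink {V : Type*} (A : V → V → Prop) (w : V) : Prop := ∀ v, ¬ A w v

/-- The vertices from which the arrows lead to the orbit of `r`. If `r` is a sink, this is the
preimage of the component of `r` in the forest. -/
def basin (G : Type*) [Group G] {V : Type*} [MulAction G V] (A : V → V → Prop) (r : V) : Set V :=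
  {x | ∃ g : G, Relation.ReflTransGen A x (g • r)}

namespace IsCompressing

variable {A : V → V → Prop}

theorem stabilizer_le (hA : S.IsCompressing A) {u v : V} (h : A u v) :
    stabilizer G u ≤ stabilizer G v := by
  have h1 := hA.stabilizer_eq (hA.adj h) h
  rw [S.stabilizer_edge, stabilizer_mk_eq] at h1
  exact inf_eq_left.1 h1

theorem stabilizer_le_of_reflTransGen (hA : S.IsCompressing A) {u v : V}
    (h : Relation.ReflTransGen A u v) : stabilizer G u ≤ stabilizer G v := by
  induction h with
  | refl => exact le_rfl
  | tail _ h ih => exact ih.trans (hA.stabilizer_le h)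

theorem smul_iff (hA : S.IsCompressing A) (g : G) {u v : V} : A (g • u) (g • v) ↔ A u v :=
  ⟨fun h => by simpa using hA.smul g⁻¹ h, hA.smul g⟩

theorem isSink_smul (hA : S.IsCompressing A) {w : V} (h : IsSink A w) (g : G) :
    IsSink A (g • w) := fun v hv => h (g⁻¹ • v) ((hA.smul_iff g).1 (by rwa [smul_inv_smul]))

theorem stable_basin (hA : S.IsCompressing A) (r : V) : IsStable G (basin G A r) := by
  rintro g x ⟨k, hk⟩
  refine ⟨g * k, ?_⟩
  rw [mul_smul]
  exact hk.lift (fun x => g • x) fun _ _ h => hA.smul g h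

theorem mem_basin_iff (hA : S.IsCompressing A) {r : V} (hr : IsSink A r) {x y : V} (h : A x y) :
    x ∈ basin G A r ↔ y ∈ basin G A r := by
  constructor
  · rintro ⟨g, hg⟩
    rcases Relation.ReflTransGen.cases_head hg with rfl | ⟨z, hxz, hz⟩
    · exact absurd h (hA.isSink_smul hr g y)
    · obtain ⟨k, -, rfl⟩ := hA.out_unique 1 hxz ((one_smul G x).symm ▸ h)
      exact hA.stable_basin r k z ⟨g, hz⟩
  · rintro ⟨g, hg⟩
    exact ⟨g, .head h hg⟩

theorem mem_forestEdges_iff (hA : S.IsCompressing A) {u v : V} (h : S.graph.Adj u v) :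
    S.quotMk (S.edge h) ∈ S.forestEdges A ↔ A u v ∨ A v u := by
  constructor
  · rintro ⟨x, y, hxy, ha, heq⟩
    obtain ⟨g, ⟨rfl, rfl⟩ | ⟨rfl, rfl⟩⟩ := (S.quotMk_edge_eq_iff h hxy).1 heq
    · exact Or.inl (hA.smul g ha)
    · exact Or.inr (hA.smul g ha)
  · rintro (ha | ha)
    · exact ⟨u, v, h, ha, rfl⟩
    · exact ⟨v, u, h.symm, ha, (S.quotMk_edge_eq_iff h h.symm).2
        ⟨1, Or.inr ⟨one_smul _ _, one_smul _ _⟩⟩⟩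

/-- Reversing the arrow from `u` to a sink `r` with the same stabilizer turns `u` into a sink and
does not change the set of edges of the forest. -/
theorem exists_reverse (hA : S.IsCompressing A) {u r : V} (hur : A u r) (hr : IsSink A r)
    (hst : stabilizer G r ≤ stabilizer G u) :
    ∃ A' : V → V → Prop, S.IsCompressing A' ∧ S.forestEdges A' = S.forestEdges A ∧
      IsSink A' u := by
  let A' : V → V → Prop := fun x y =>
    (A x y ∧ x ∉ orbit G u) ∨ ∃ g : G, x = g • r ∧ y = g • u
  have hnot : ∀ g : G, g • r ∉ orbit G u := by
    rintro g ⟨k, hk⟩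
    have h1 : A (k • u) (k • r) := hA.smul k hur
    rw [show k • u = g • r from hk] at h1
    exact hA.isSink_smul hr g _ h1
  have hsink : ∀ x ∈ orbit G u, ∀ y, ¬ A' x y := by
    rintro x hx y (⟨-, h⟩ | ⟨g, rfl, rfl⟩)
    · exact h hx
    · exact hnot g hx
  have hadj : ∀ {x y}, A' x y → S.graph.Adj x y := by
    rintro x y (⟨h, -⟩ | ⟨g, rfl, rfl⟩)
    · exact hA.adj h
    · exact S.adj_smul g (hA.adj hur).symm
  have hA' : S.IsCompressing A' := by
    refine ⟨hadj, ?_, ?_, ?_, ?_⟩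
    · rintro g x y (⟨h, hx⟩ | ⟨k, rfl, rfl⟩)
      · exact Or.inl ⟨hA.smul g h, fun h' => hx ((isStable_orbit u).smul_mem_iff.1 h')⟩
      · exact Or.inr ⟨g * k, (mul_smul _ _ _).symm, (mul_smul _ _ _).symm⟩
    · rintro x y h (⟨h', -⟩ | ⟨g, rfl, rfl⟩)
      · exact hA.stabilizer_eq h h'
      · exact stabilizer_edge_eq_left h (smul_le_stabilizer_smul le_rfl hst g)
    · rintro g x y z (⟨h, hx⟩ | ⟨k, rfl, rfl⟩) (⟨h', -⟩ | ⟨k', hk', rfl⟩)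
      · exact hA.out_unique g h h'
      · have h1 := hA.smul g h
        rw [hk'] at h1
        exact absurd h1 (hA.isSink_smul hr k' _)
      · rw [← mul_smul] at h'
        exact absurd h' (hA.isSink_smul hr _ _)
      · refine ⟨k' * k⁻¹, ?_, ?_⟩
        · rw [mul_smul, inv_smul_smul, hk']
        · rw [mul_smul, inv_smul_smul]
    · intro g x hx
      -- No arrow leaves the orbit of `u`, so a closed path avoids it and uses only old arrows.
      have key : ∀ y, Relation.TransGen A' x y → y ∉ orbit G u → Relation.TransGen A x y := by
        intro y hy
        induction hy with
        | single h =>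
          rintro hyu
          rcases h with ⟨h, -⟩ | ⟨g, rfl, rfl⟩
          · exact .single h
          · exact absurd (mem_orbit u g) hyu
        | tail hxy h ih =>
          rename_i y z
          intro hz
          have hy : y ∉ orbit G u := fun hy => hsink y hy z h
          rcases h with ⟨h, -⟩ | ⟨g, rfl, rfl⟩
          · exact .tail (ih hy) h
          · exact absurd (mem_orbit u g) hz
      refine hA.acyclic g x (key _ hx fun hgx => ?_)
      obtain ⟨y, hy, -⟩ := Relation.TransGen.head'_iff.1 hx
      exact hsink x ((isStable_orbit u).smul_mem_iff.1 hgx) y hy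
  refine ⟨A', hA', ?_, hsink u (mem_orbit_self u)⟩
  ext e
  constructor
  · rintro ⟨x, y, h, ⟨h', -⟩ | ⟨g, rfl, rfl⟩, rfl⟩
    · exact ⟨x, y, h, h', rfl⟩
    · exact (hA.mem_forestEdges_iff h).2 (Or.inr (hA.smul g hur))
  · rintro ⟨x, y, h, h', rfl⟩
    rw [hA'.mem_forestEdges_iff h]
    by_cases hx : x ∈ orbit G u
    · obtain ⟨g, rfl⟩ := hx
      obtain ⟨k, hk, rfl⟩ := hA.out_unique g hur h'
      exact Or.inr (Or.inr ⟨k, rfl, hk.symm⟩)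
    · exact Or.inl (Or.inl ⟨h', hx⟩)

/-- The orientation of a compressing forest can be changed so that a vertex `w` becomes a sink, if
`w` leads to a sink with the same stabilizer. -/
theorem exists_isSink (hA : S.IsCompressing A) {w r : V} (hwr : Relation.ReflTransGen A w r)
    (hr : IsSink A r) (hst : stabilizer G r ≤ stabilizer G w) :
    ∃ A' : V → V → Prop, S.IsCompressing A' ∧ S.forestEdges A' = S.forestEdges A ∧
      IsSink A' w := by
  induction hwr using Relation.ReflTransGen.head_induction_on with
  | refl => exact ⟨A, hA, rfl, hr⟩
  | @head w w' hww' hp ih =>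
    obtain ⟨A', hA', hF, hs⟩ := ih (hst.trans (hA.stabilizer_le hww'))
    have h1 : A' w w' := by
      have h2 := (hA.mem_forestEdges_iff (hA.adj hww')).2 (Or.inl hww')
      rw [← hF, hA'.mem_forestEdges_iff] at h2
      exact h2.resolve_right (hs w)
    obtain ⟨A'', hA'', hF', hs'⟩ :=
      hA'.exists_reverse h1 hs ((hA.stabilizer_le_of_reflTransGen hp).trans hst)
    exact ⟨A'', hA'', hF'.trans hF, hs'⟩

/-- An arrow from a sink `w` to a vertex of another component can be added to the forest. -/
theorem insert_arrow (hA : S.IsCompressing A) {w w' : V} (hw : IsSink A w)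
    (hadj : S.graph.Adj w w') (hle : stabilizer G w ≤ stabilizer G w') (hb : w' ∉ basin G A w) :
    S.IsCompressing fun x y => A x y ∨ ∃ g : G, x = g • w ∧ y = g • w' := by
  refine ⟨?_, ?_, ?_, ?_, ?_⟩
  · rintro x y (h | ⟨g, rfl, rfl⟩)
    · exact hA.adj h
    · exact S.adj_smul g hadj
  · rintro g x y (h | ⟨k, rfl, rfl⟩)
    · exact Or.inl (hA.smul g h)
    · exact Or.inr ⟨g * k, (mul_smul _ _ _).symm, (mul_smul _ _ _).symm⟩
  · rintro x y h (h' | ⟨g, rfl, rfl⟩)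
    · exact hA.stabilizer_eq h h'
    · exact stabilizer_edge_eq_left h (smul_le_stabilizer_smul le_rfl hle g)
  · rintro g x y z (h | ⟨k, rfl, rfl⟩) (h' | ⟨k', hk', rfl⟩)
    · exact hA.out_unique g h h'
    · have h1 := hA.smul g h
      rw [hk'] at h1
      exact absurd h1 (hA.isSink_smul hw k' _)
    · rw [← mul_smul] at h'
      exact absurd h' (hA.isSink_smul hw _ _)
    · refine ⟨k' * k⁻¹, ?_, ?_⟩
      · rw [mul_smul, inv_smul_smul, hk']
      · rw [mul_smul, inv_smul_smul]
  · -- The new arrows lead out of the basin of `w` and no arrow leads into it.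
    have key : ∀ x y, Relation.TransGen (fun x y => A x y ∨ ∃ g : G, x = g • w ∧ y = g • w') x y →
        (y ∈ basin G A w → x ∈ basin G A w) ∧
          ((x ∈ basin G A w → y ∈ basin G A w) → Relation.TransGen A x y) := by
      have hin : ∀ g : G, g • w ∈ basin G A w := fun g => ⟨g, .refl⟩
      have hout : ∀ g : G, g • w' ∉ basin G A w := fun g h =>
        hb ((hA.stable_basin w).smul_mem_iff.1 h)
      intro x y h
      induction h with
      | single h =>
        rcases h with h | ⟨g, rfl, rfl⟩
        · exact ⟨(hA.mem_basin_iff hw h).2, fun _ => .single h⟩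
        · exact ⟨fun h => absurd h (hout g), fun h => absurd (h (hin g)) (hout g)⟩
      | tail _ h ih =>
        rcases h with h | ⟨g, rfl, rfl⟩
        · have h1 := hA.mem_basin_iff hw h
          exact ⟨fun h2 => ih.1 (h1.2 h2), fun h2 => .tail (ih.2 fun h3 => h1.2 (h2 h3)) h⟩
        · exact ⟨fun h => absurd h (hout g), fun h => absurd (h (ih.1 (hin g))) (hout g)⟩
    intro g x hx
    exact hA.acyclic g x ((key _ _ hx).2 fun h => hA.stable_basin w g x h)

/-- In a maximal compressing forest, every path of compressible edges that starts in a sink `r`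
stays in the component of `r`: otherwise the forest could be reoriented towards the end of such a
path, and then enlarged. -/
theorem mem_basin_of_reflTransGen (hfin : S.FiniteEdgeStabilizers) (hA : S.IsCompressing A)
    (hmax : S.IsCompressingForest (S.forestEdges A)) {r w : V} (hr : IsSink A r)
    (hrw : Relation.ReflTransGen (StabArrow G (S.orientedOver Set.univ)) r w) :
    w ∈ basin G A r := by
  induction hrw with
  | refl => exact ⟨1, by rw [one_smul]⟩
  | @tail w w' hp hww' ih =>
    have hadj := adj_of_stabArrow le_rfl hww'
    have hfw : Finite (stabilizer G w) := by
      rw [← stabilizer_edge_eq_left hadj hww'.2]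
      exact hfin _
    obtain ⟨g, hg⟩ := ih
    have h1 := _root_.stabilizer_le_of_reflTransGen hp
    have h2 := hA.stabilizer_le_of_reflTransGen hg
    have h3 : stabilizer G w = stabilizer G (g • r) := by
      have hfr : Finite (stabilizer G r) :=
        Finite.of_injective _ (Subgroup.inclusion_injective h1)
      have hfg := finite_stabilizer_of_mem_orbit (mem_orbit r g) hfr
      refine Subgroup.eq_of_le_of_card_ge h2 ?_
      rw [card_stabilizer_smul]
      exact Subgroup.card_le_of_le h1
    obtain ⟨A', hA', hF, hs⟩ := hA.exists_isSink hg (hA.isSink_smul hr g) h3.ge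
    have hb : w' ∈ basin G A' w := by
      by_contra hb
      have hnew := hA'.insert_arrow hs hadj hww'.2 hb
      have hsub : S.forestEdges A ⊆
          S.forestEdges fun x y => A' x y ∨ ∃ g : G, x = g • w ∧ y = g • w' := by
        rw [← hF]
        rintro e ⟨x, y, h, h', rfl⟩
        exact ⟨x, y, h, Or.inl h', rfl⟩
      have hmem := hmax.2 ⟨_, hnew, rfl⟩ hsub
        ⟨w, w', hadj, Or.inr ⟨1, (one_smul _ _).symm, (one_smul _ _).symm⟩, rfl⟩
      rw [← hF, hA'.mem_forestEdges_iff] at hmem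
      rcases hmem with h | h
      · exact hs _ h
      · exact hb ⟨1, by
          rw [one_smul]
          exact .single h⟩
    obtain ⟨k, hk⟩ := hb
    have hkw : k • w ∈ basin G A r := hA.stable_basin r k w ⟨g, hg⟩
    -- Both orientations have the same edges, hence the same components.
    have key : ∀ x, Relation.ReflTransGen A' x (k • w) → x ∈ basin G A r := by
      intro x hx
      induction hx using Relation.ReflTransGen.head_induction_on with
      | refl => exact hkw
      | head hxy _ ih =>
        have h4 := (hA'.mem_forestEdges_iff (hA'.adj hxy)).2 (Or.inl hxy)
        rw [hF, hA.mem_forestEdges_iff] at h4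
        rcases h4 with h4 | h4
        · exact (hA.mem_basin_iff hr h4).2 ih
        · exact (hA.mem_basin_iff hr h4).1 ih
    exact key _ hk

theorem mass_sinks_le (hfin : S.FiniteEdgeStabilizers) (hA : S.IsCompressing A)
    (hmax : S.IsCompressingForest (S.forestEdges A)) {R : Set V}
    (hR : Dominates G (S.orientedOver Set.univ) R) : mass G {w | IsSink A w} ≤ mass G R := by
  choose f hfR hf using hR
  have hb : ∀ y, IsSink A y → f y ∈ basin G A y := fun y hy =>
    hA.mem_basin_of_reflTransGen hfin hmax hy (hf y)
  refine mass_le_of_orbit_injection f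
    (fun y hy => ⟨f y, hfR y, ⟨1, one_smul _ _⟩, ?_⟩) ?_
  · obtain ⟨g, hg⟩ := hb y hy
    have hle := hA.stabilizer_le_of_reflTransGen hg
    rw [← stabInv_smul g y]
    by_cases hfin' : Finite (stabilizer G (g • y))
    · have : Finite (stabilizer G (f y)) :=
        Finite.of_injective _ (Subgroup.inclusion_injective hle)
      exact stabInv_le_of_le hle
    · have : Infinite (stabilizer G (g • y)) := not_finite_iff_infinite.1 hfin'
      have h0 : stabInv G (g • y) = 0 := by
        rw [stabInv, Nat.card_eq_zero_of_infinite]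
        simp
      rw [h0]
      exact zero_le
  · rintro y hy y' hy' ⟨g, hg⟩
    have h1 : f y ∈ basin G A y' := by
      have h2 := hb y' hy'
      rw [← hg] at h2
      exact (hA.stable_basin y').smul_mem_iff.1 h2
    obtain ⟨k, hk⟩ := hb y hy
    have key : ∀ z, Relation.ReflTransGen A (f y) z → z ∈ basin G A y' := by
      intro z hz
      induction hz with
      | refl => exact h1
      | tail _ h ih => exact (hA.mem_basin_iff hy' h).1 ih
    obtain ⟨l, hl⟩ := (hA.stable_basin y').smul_mem_iff.1 (key _ hk)
    rcases Relation.ReflTransGen.cases_head hl with rfl | ⟨z, hz, -⟩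
    · exact ⟨l⁻¹, inv_smul_smul _ _⟩
    · exact absurd hz (hy z)

/-- The arrows of a compressing forest correspond to the vertices that are compressed, and they have
the same stabilizers. -/
theorem mass_not_sink_le (hA : S.IsCompressing A) :
    mass G {w | ¬ IsSink A w} ≤ mass G (S.orientedOver (S.forestEdges A)) := by
  have key : ∀ w, ∃ d : V × V, ¬ IsSink A w → ∃ v, A w v ∧ (d = (w, v) ∨ d = (v, w)) ∧
      d ∈ S.orientedOver (S.forestEdges A) := by
    intro w
    by_cases hw : IsSink A w
    · exact ⟨(w, w), fun h => absurd hw h⟩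
    · unfold IsSink at hw
      push Not at hw
      obtain ⟨v, hv⟩ := hw
      rcases (S.mem_orientedOver_or (hA.adj hv)).2
        ((hA.mem_forestEdges_iff (hA.adj hv)).2 (Or.inl hv)) with h | h
      · exact ⟨(w, v), fun _ => ⟨v, hv, Or.inl rfl, h⟩⟩
      · exact ⟨(v, w), fun _ => ⟨v, hv, Or.inr rfl, h⟩⟩
  choose f hf using key
  refine mass_le_of_orbit_injection f (fun y hy => ?_) ?_
  · obtain ⟨v, hv, h, hmem⟩ := hf y hy
    refine ⟨f y, hmem, ⟨1, one_smul _ _⟩, (stabInv_congr ?_).le⟩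
    have hle := hA.stabilizer_le hv
    rcases h with h | h
    · rw [h, stabilizer_mk_eq]
      exact (inf_eq_left.2 hle).symm
    · rw [h, stabilizer_mk_eq]
      exact (inf_eq_right.2 hle).symm
  · rintro y hy y' hy' ⟨g, hg⟩
    obtain ⟨v, hv, h, -⟩ := hf y hy
    obtain ⟨v', hv', h', -⟩ := hf y' hy'
    -- Opposite arrows on an edge would form a circuit.
    have hno : g • y = v' → g • v = y' → ∃ g : G, g • y = y' := by
      rintro rfl rfl
      refine absurd (Relation.TransGen.tail (.single hv) ((hA.smul_iff g).1 hv')) ?_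
      have := hA.acyclic 1 y
      rwa [one_smul] at this
    rcases h with h | h <;> rcases h' with h' | h' <;>
      rw [h, h', Prod.smul_mk, Prod.mk.injEq] at hg
    · exact ⟨g, hg.1⟩
    · exact hno hg.1 hg.2
    · exact hno hg.2 hg.1
    · exact ⟨g, hg.2⟩

end IsCompressing

theorem exists_finset_orbit_representatives [Finite S.QuotEdge] :
    ∃ K : Finset V, ∀ T : Set V, IsStable G T → (∀ k ∈ K, k ∈ T) → T = Set.univ := by
  classical
  obtain ⟨v₀⟩ := S.isTree.1.nonempty
  have := Fintype.ofFinite S.QuotEdge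
  refine ⟨insert v₀ (Finset.univ.image (fun x => (S.liftEdge x).1) ∪
    Finset.univ.image fun x => (S.liftEdge x).2), fun T hT hK => Set.eq_univ_of_forall fun v => ?_⟩
  obtain ⟨p⟩ := S.isTree.1.preconnected v v₀
  cases p with
  | nil => exact hK _ (Finset.mem_insert_self _ _)
  | cons hadj _ =>
    obtain ⟨g, ⟨h, -⟩ | ⟨-, h⟩⟩ :=
      (S.quotMk_edge_eq_iff hadj (S.adj_liftEdge _)).1 (S.quotMk_liftEdge _).symm
    · rw [← h]
      exact hT g _ (hK _ (Finset.mem_insert_of_mem (Finset.mem_union_left _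
        (Finset.mem_image_of_mem _ (Finset.mem_univ _)))))
    · rw [← h]
      exact hT g _ (hK _ (Finset.mem_insert_of_mem (Finset.mem_union_right _
        (Finset.mem_image_of_mem _ (Finset.mem_univ _)))))

theorem etaOutside_le (hfin : S.FiniteEdgeStabilizers) {B : Finset G}
    (hB : Subgroup.closure (B : Set G) = ⊤) [Finite S.QuotEdge] {F : Set S.QuotEdge}
    (hF : S.IsCompressingForest F) : S.etaOutside F ≤ B.card := by
  obtain ⟨K, hK⟩ := exists_finset_orbit_representatives (S := S)
  obtain ⟨T, E, R, h, hKT⟩ := S.exists_isBoundedSubtree hfin hB K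
  obtain rfl := hK T h.stable hKT
  obtain rfl := h.edges_eq
  obtain ⟨A, hA, rfl⟩ := hF.1
  have hsinks := hA.mass_sinks_le hfin hF (R := R) fun w => h.dominates w trivial
  have hC := hA.mass_not_sink_le
  have fV := mass_ne_top h.finite_vertices
  have fE := mass_ne_top h.finite_edges
  have hV : mass G (Set.univ : Set V) ≤
      mass G R + mass G (S.orientedOver (S.forestEdges A)) := by
    refine le_trans (mass_mono fun w _ => ?_)
      ((mass_union_le {w | IsSink A w} {w | ¬ IsSink A w}).trans (add_le_add hsinks hC))
    exact em _
  have hsplit : mass G (S.orientedOver Set.univ) =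
      mass G (S.orientedOver (S.forestEdges A)) + S.etaOutside (S.forestEdges A) := by
    rw [mass_orientedOver_univ, mass_orientedOver, eta, etaOutside]
    exact (ENNReal.summable.tsum_add_tsum_compl ENNReal.summable).symm
  have hb := h.bound
  rw [hsplit] at hb fE
  have f1 : mass G R + mass G (S.orientedOver (S.forestEdges A)) ≠ ∞ :=
    ENNReal.add_ne_top.2 ⟨ne_top_of_le_ne_top fV (mass_mono (Set.subset_univ _)),
      (ENNReal.add_ne_top.1 fE).1⟩
  refine (ENNReal.add_le_add_iff_right f1).1 ?_
  calc S.etaOutside (S.forestEdges A) + (mass G R + mass G (S.orientedOver (S.forestEdges A)))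
      = mass G (S.orientedOver (S.forestEdges A)) + S.etaOutside (S.forestEdges A) + mass G R := by
        ring
    _ ≤ _ := hb
    _ ≤ _ := by
        simp only [ENNReal.coe_natCast]
        gcongr

theorem eta_eq_card (h : ∀ e : S.Edge, stabilizer G e = ⊥) : S.eta = ENat.card S.QuotEdge := by
  have : ∀ x, S.weight x = 1 := by
    intro x
    rw [← S.quotMk_liftEdge x, weight_quotMk, stabInv, ← S.stabilizer_edge (S.adj_liftEdge x), h]
    simp
  rw [eta, tsum_congr this, ENNReal.tsum_one]

end GTree

/-- `Group.rank G` is the minimal number `d(G)` of generators of the finitely generated group `G`.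
The first part is for reduced `S` (with its special case of trivial edge stabilizers); the second
is for arbitrary `G`-finite `S`, where `η(S)` is computed on the reduced tree obtained from `S`
by means of a compressing forest. -/
theorem theorem2p3 {G : Type*} [Group G] [Group.FG G] {V : Type*} [MulAction G V]
    (S : GTree G V) (hfin : S.FiniteEdgeStabilizers) :
    (S.IsReduced →
      Finite S.QuotEdge ∧ S.eta ≤ (Group.rank G : ℝ≥0∞) ∧
        ((∀ e : S.Edge, MulAction.stabilizer G e = ⊥) → Nat.card S.QuotEdge ≤ Group.rank G)) ∧
    (Finite S.QuotEdge →
      ∀ F : Set S.QuotEdge, S.IsCompressingForest F →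
        S.etaOutside F ≤ (Group.rank G : ℝ≥0∞)) := by
  obtain ⟨B, hcard, hB⟩ := Group.rank_spec G
  rw [← hcard]
  refine ⟨fun hred => ?_, fun _ F hF => GTree.etaOutside_le hfin hB hF⟩
  obtain ⟨hf, hle⟩ := GTree.finite_and_eta_le_of_isReduced hfin hB hred
  refine ⟨hf, hle, fun htriv => ?_⟩
  rw [GTree.eta_eq_card htriv, ENat.card_eq_coe_natCard] at hle
  exact_mod_cast hle
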